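/- **Definitions.** All graphs are finite with non-empty vertex set. A directed graph $G=(V,E)$ has $E\subseteq V\times V$ (reflexive edges allowed); it is undirected if $E$ is symmetric. A $2$-featured graph carries a map $f\colon V\to\{0,1\}^2$. A *vertex property* is a property of pointed $2$-featured graphs $(G,v)$, $v\in V$. An FO (respectively $\mathrm{C}^2$) classifier is a formula with one free variable of first-order logic with equality (respectively of its two-variable fragment with counting quantifiers $\exists^{\ge k}$) over the edge relation and two unary predicates $P_1,P_2$, where $P_i(v)$ holds iff $f(v)[i]=1$. A simple ACR-GNN with input dimension $2$ consists of finitely many layers and a classifier $\mathrm{cls}$. Starting from $f^{(0)}=f$, the $i$-th layer computes $$f^{(i)}(v)=\mathrm{ReLU}\Big(f^{(i-1)}(v)A_i+\Big(\sum_{u:(v,u)\in E}f^{(i-1)}(u)\Big)C_i+\Big(\sum_{u\in V}f^{(i-1)}(u)\Big)R_i+b_i\Big)$$ with real matrices $A_i,C_i,R_i$ and real vectors $b_i$; the last embedding $f^{(L)}$ is one-dimensional, and $(G,v)$ is accepted iff $\mathrm{cls}(f^{(L)}(v))=1$, where $\mathrm{cls}(x)=1$ iff $ax\ge b$ for fixed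 $a,b\in\mathbb{R}$. A classifier or GNN *captures* a vertex property over undirected graphs if it accepts exactly those pointed undirected $2$-featured graphs that have the property. The *gadgetisation* of a directed graph $(V,E)$ is the undirected $2$-featured graph with pairwise distinct vertices $s_v$ (source), $t_v$ (sink), $\iota_v$ (identity) for $v\in V$, with undirected edges $\{s_v,t_u\}$ for $(v,u)\in E$ and $\{s_v,\iota_v\},\{\iota_v,t_v\}$ for $v\in V$, and with features $f(s_v)=(1,0)$, $f(t_v)=(0,1)$, $f(\iota_v)=(0,0)$. **Theorem.** There is an FO vertex property over undirected graphs that is not equivalent (over undirected graphs) to any $\mathrm{C}^2$ classifier, but is captured by a simple ACR-GNN. Specifically, the property that $G$ is (isomorphic to) the gadgetisation of a strict linear order is captured over undirected graphs by an FO classifier and by a simple ACR-GNN, but by no $\mathrm{C}^2$ classifier. -/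

import Mathlib

open scoped Matrix

universe u

noncomputable section

/-! ### Featured graphs -/

/-- A directed graph on the vertex set `V` (reflexive edges allowed) in which every vertex carries
a feature vector in `{0, 1}ᵈ`. -/
structure FeaturedGraph (d : ℕ) (V : Type u) extends Digraph V where
  /-- `feat v i = true` means that the `i`-th component of the feature vector of `v` is `1`. -/
  feat : V → Fin d → Bool

namespace FeaturedGraph

variable {d : ℕ} {V : Type u}

/-- The edge relation is symmetric; reflexive edges are not excluded. -/
def IsUndirected (G : FeaturedGraph d V) : Prop :=
  ∀ v w, G.Adj v w → G.Adj w v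

/-- The feature vectors, read as real vectors. -/
def realFeat (G : FeaturedGraph d V) (v : V) : Fin d → ℝ :=
  fun i => if G.feat v i = true then 1 else 0

open Classical in
/-- The out-neighbourhood of a vertex of a finite graph. -/
def outNeighbors [Fintype V] (G : FeaturedGraph d V) (v : V) : Finset V :=
  Finset.univ.filter fun w => G.Adj v w

end FeaturedGraph

/-- A property of finite pointed `d`-featured graphs `(G, v)`. -/
abbrev VertexProperty (d : ℕ) : Type (u + 1) :=
  ∀ (V : Type u) [Fintype V], FeaturedGraph d V → V → Prop

/-- `P` and `Q` hold of the same finite pointed undirected `d`-featured graphs. -/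
def EquivOverUndirected {d : ℕ} (P Q : VertexProperty.{u} d) : Prop :=
  ∀ (V : Type u) [Fintype V] (G : FeaturedGraph d V) (v : V),
    G.IsUndirected → (P V G v ↔ Q V G v)

/-! ### First-order classifiers -/

/-- The relation symbols for `d`-featured graphs: `d` unary predicates and one binary relation. -/
inductive FeaturedRel (d : ℕ) : ℕ → Type
  | feat (i : Fin d) : FeaturedRel d 1
  | edge : FeaturedRel d 2

/-- The first-order language of `d`-featured graphs. -/
def featuredLanguage (d : ℕ) : FirstOrder.Language.{0, 0} :=
  ⟨fun _ => Empty, FeaturedRel d⟩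

/-- A featured graph as a first-order structure. -/
@[reducible]
def FeaturedGraph.toStructure {d : ℕ} {V : Type u} (G : FeaturedGraph d V) :
    (featuredLanguage d).Structure V where
  funMap := fun f _ => Empty.elim f
  RelMap := fun {_} r =>
    match r with
    | .feat i => fun x => G.feat (x 0) i = true
    | .edge => fun x => G.Adj (x 0) (x 1)

/-- An FO classifier: a first-order formula (with equality) with one free variable. -/
abbrev FOClassifier (d : ℕ) : Type := (featuredLanguage d).Formula (Fin 1)

/-- The vertex property defined by an FO classifier. -/
def FOClassifier.property {d : ℕ} (φ : FOClassifier d) : VertexProperty.{u} d :=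
  fun V _ G v => @FirstOrder.Language.Formula.Realize (featuredLanguage d) V G.toStructure (Fin 1)
    φ (fun _ => v)

/-! ### Two-variable logic with counting -/

/-- Formulas of `C²` over `d`-featured graphs; the two variables are the elements of `Fin 2`. -/
inductive C2Formula (d : ℕ) : Type
  | eq (i j : Fin 2) : C2Formula d
  | edge (i j : Fin 2) : C2Formula d
  | feat (p : Fin d) (i : Fin 2) : C2Formula d
  | neg (φ : C2Formula d) : C2Formula d
  | and (φ ψ : C2Formula d) : C2Formula d
  /-- `existsGE k i φ` is the counting quantifier `∃^{≥ k} xᵢ φ`. -/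
  | existsGE (k : ℕ) (i : Fin 2) (φ : C2Formula d) : C2Formula d

namespace C2Formula

variable {d : ℕ} {V : Type u}

/-- Satisfaction of a formula under an assignment of the two variables. -/
def Realize (G : FeaturedGraph d V) : C2Formula d → (Fin 2 → V) → Prop
  | eq i j, σ => σ i = σ j
  | edge i j, σ => G.Adj (σ i) (σ j)
  | feat p i, σ => G.feat (σ i) p = true
  | neg φ, σ => ¬ φ.Realize G σ
  | and φ ψ, σ => φ.Realize G σ ∧ ψ.Realize G σ
  | existsGE k i φ, σ => k ≤ Nat.card {a : V // φ.Realize G (Function.update σ i a)}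

/-- The free variables of a formula. -/
def freeVars : C2Formula d → Finset (Fin 2)
  | eq i j => {i, j}
  | edge i j => {i, j}
  | feat _ i => {i}
  | neg φ => φ.freeVars
  | and φ ψ => φ.freeVars ∪ ψ.freeVars
  | existsGE _ i φ => φ.freeVars.erase i

end C2Formula

/-- A `C²` classifier: a `C²` formula in which no variable but the first occurs free. -/
structure C2Classifier (d : ℕ) : Type where
  formula : C2Formula d
  freeVars_subset : formula.freeVars ⊆ {0}

/-- The vertex property defined by a `C²` classifier. (The value given to the second variable, which
is not free, is irrelevant.) -/
def C2Classifier.property {d : ℕ} (ψ : C2Classifier d) : VertexProperty.{u} d :=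
  fun _ _ G v => ψ.formula.Realize G (fun _ => v)

/-! ### Aggregate-combine-readout graph neural networks -/

/-- One layer of an ACR-GNN, from embeddings in `ℝᵐ` to embeddings in `ℝⁿ`. -/
structure ACRLayer (m n : ℕ) where
  comb : (Fin m → ℝ) → (Fin m → ℝ) → (Fin m → ℝ) → (Fin n → ℝ)
  agg : Multiset (Fin m → ℝ) → (Fin m → ℝ)
  read : Multiset (Fin m → ℝ) → (Fin m → ℝ)

/-- The embedding that a layer computes from the embedding `f`. -/
def ACRLayer.apply {m n d : ℕ} (ℓ : ACRLayer m n) {V : Type u} [Fintype V]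
    (G : FeaturedGraph d V) (f : V → Fin m → ℝ) : V → Fin n → ℝ :=
  fun v => ℓ.comb (f v) (ℓ.agg ((G.outNeighbors v).val.map f))
    (ℓ.read ((Finset.univ : Finset V).val.map f))

/-- The coordinatewise rectified linear unit. -/
def reluVec {n : ℕ} (x : Fin n → ℝ) : Fin n → ℝ :=
  fun j => max 0 (x j)

/-- A simple layer: aggregation and readout are sums, and the combination function is an affine map
followed by ReLU. -/
def ACRLayer.IsSimple {m n : ℕ} (ℓ : ACRLayer m n) : Prop :=
  (∃ (A C R : Matrix (Fin m) (Fin n) ℝ) (b : Fin n → ℝ),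
      ∀ x₁ x₂ x₃, ℓ.comb x₁ x₂ x₃ = reluVec (x₁ ᵥ* A + x₂ ᵥ* C + x₃ ᵥ* R + b)) ∧
    (∀ M, ℓ.agg M = M.sum) ∧ (∀ M, ℓ.read M = M.sum)

/-- A finite sequence of layers with matching dimensions, the first of which is applied first. -/
inductive ACRLayers : ℕ → ℕ → Type
  | nil (n : ℕ) : ACRLayers n n
  | cons {m n k : ℕ} (ℓ : ACRLayer m n) (rest : ACRLayers n k) : ACRLayers m k

/-- The embedding computed by a sequence of layers from the embedding `f`. -/
def ACRLayers.apply {d : ℕ} {V : Type u} [Fintype V] (G : FeaturedGraph d V) :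
    {m n : ℕ} → ACRLayers m n → (V → Fin m → ℝ) → (V → Fin n → ℝ)
  | _, _, .nil _, f => f
  | _, _, .cons ℓ rest, f => rest.apply G (ℓ.apply G f)

/-- Every layer of the sequence is simple. -/
def ACRLayers.IsSimple : {m n : ℕ} → ACRLayers m n → Prop
  | _, _, .nil _ => True
  | _, _, .cons ℓ rest => ℓ.IsSimple ∧ rest.IsSimple

/-- An ACR-GNN with input dimension `d`. -/
structure ACRGNN (d : ℕ) where
  outDim : ℕ
  layers : ACRLayers d outDim
  cls : (Fin outDim → ℝ) → Bool

/-- A simple ACR-GNN: all layers are simple, and the classifier is a linear threshold function on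
`ℝ`. -/
def ACRGNN.IsSimple {d : ℕ} (N : ACRGNN d) : Prop :=
  N.layers.IsSimple ∧ N.outDim = 1 ∧
    ∃ (a : Fin N.outDim → ℝ) (b : ℝ), ∀ x, N.cls x = true ↔ b ≤ ∑ i, a i * x i

/-- The vertex property of being accepted by an ACR-GNN. -/
def ACRGNN.property {d : ℕ} (N : ACRGNN d) : VertexProperty.{u} d :=
  fun _ _ G v => N.cls (N.layers.apply G G.realFeat v) = true

/-! ### Gadgetisations -/

/-- The vertices of a gadgetisation: a source, a sink and an identity node for each `w : W`. -/
inductive GadgetVertex (W : Type u) : Type u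
  | source (w : W) : GadgetVertex W
  | sink (w : W) : GadgetVertex W
  | ident (w : W) : GadgetVertex W

/-- The gadgetisation of a directed graph `D`, a 2-featured undirected graph. -/
def Digraph.gadgetisation {W : Type u} (D : Digraph W) : FeaturedGraph 2 (GadgetVertex W) where
  Adj
    | .source v, .sink w => D.Adj v w
    | .sink w, .source v => D.Adj v w
    | .source v, .ident w => v = w
    | .ident w, .source v => v = w
    | .ident v, .sink w => v = w
    | .sink w, .ident v => v = w
    | _, _ => False
  feat
    | .source _ => ![true, false]
    | .sink _ => ![false, true]
    | .ident _ => ![false, false]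

/-- Isomorphism of featured graphs. -/
def FeaturedGraph.Isomorphic {d : ℕ} {V V' : Type u} (G : FeaturedGraph d V)
    (G' : FeaturedGraph d V') : Prop :=
  ∃ e : V ≃ V', (∀ v w, G.Adj v w ↔ G'.Adj (e v) (e w)) ∧ ∀ v, G.feat v = G'.feat (e v)

/-- The property of `(G, v)` that `G` is, up to the names of its vertices, the gadgetisation of a
strict linear order. -/
def gadgetisedStrictLinearOrder : VertexProperty.{u} 2 :=
  fun _ _ G _ => ∃ (W : Type u) (D : Digraph W),
    IsStrictTotalOrder W D.Adj ∧ G.Isomorphic D.gadgetisation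

end

/-!
An undirected 2-featured graph is the gadgetisation of a digraph if and only if it satisfies a few
local conditions (`FeaturedGraph.IsGadget`), and the digraph can be read off from the pairs of
adjacent sources and sinks (`FeaturedGraph.GadgetArc`). So being the gadgetisation of a strict
linear order is a first-order property (`FeaturedGraph.sat_gadgetOrderFormula`).

**A simple ACR-GNN captures it.** With sums over neighbours and over all vertices, a network can
compute any term built from features and constants by sums and truncated subtraction
(`CountTerm.exists_isSimple`), since the rectified linear unit is truncated subtraction on natural
numbers. Such terms check the local conditions, check that in- and out-degree of every vertex of the
digraph add up to `n - 1`, and compute the sum of the squared out-degrees: if every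
vertex adds up the out-degrees of its in-neighbours, the out-degree `d` of a vertex is counted `d`
times in total. A digraph of constant total degree `n - 1` is a strict linear order as soon as this
sum is at least `0² + ⋯ + (n - 1)²` (`isStrictTotalOrder_of_sum_sq_outDeg`).

**No `C²` classifier captures it.** Adding one loop in the middle of a long linear order destroys
the order, but a `C²` formula does not notice. If its thresholds are at most `K`, then with `r`
nested quantifiers it can identify only the positions among the first or the last `K * r`; any other
position has at least `K` positions on both sides that look alike with fewer quantifiers, so the
counts cannot tell two such positions apart (`exists_equiv_pairMatch`,
`AssignmentMatch.realize_iff`).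
-/

noncomputable section

/-! ### Strict linear orders and degree sequences -/

open Classical in
/-- The out-degree of `v` in the digraph with arc relation `R`. -/
def outDeg {W : Type*} [Fintype W] (R : W → W → Prop) (v : W) : ℕ :=
  (Finset.univ.filter fun w => R v w).card

/-- The in-degree of `v` in the digraph with arc relation `R`. -/
def inDeg {W : Type*} [Fintype W] (R : W → W → Prop) (v : W) : ℕ :=
  outDeg (fun a b => R b a) v

theorem outDeg_cast {W : Type*} [Fintype W] (R : W → W → Prop) [DecidableRel R] (v : W) :
    (outDeg R v : ℤ) = ∑ w, if R v w then 1 else 0 := by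
  rw [outDeg, Finset.card_filter]
  push_cast
  exact Finset.sum_congr rfl fun w _ => by congr

theorem inDeg_cast {W : Type*} [Fintype W] (R : W → W → Prop) [DecidableRel R] (v : W) :
    (inDeg R v : ℤ) = ∑ w, if R w v then 1 else 0 :=
  outDeg_cast (fun a b => R b a) v

/-- A sum of differences over the arcs is a sum over the vertices, weighted by out- minus
in-degree. -/
theorem sum_arcs_sub {W : Type*} [Fintype W] (R : W → W → Prop) [DecidableRel R] (g : W → ℤ) :
    ∑ u, ∑ v, (if R u v then g u - g v else 0) =
      ∑ v, g v * ((outDeg R v : ℤ) - inDeg R v) := by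
  have h1 : ∑ u, ∑ v, (if R u v then g u - g v else 0) =
      ∑ u, ∑ v, g u * (if R u v then 1 else 0) - ∑ u, ∑ v, g v * (if R u v then 1 else 0) := by
    simp only [← Finset.sum_sub_distrib]
    refine Finset.sum_congr rfl fun u _ => Finset.sum_congr rfl fun v _ => ?_
    split_ifs <;> simp
  rw [h1, Finset.sum_comm (f := fun u v => g v * (if R u v then 1 else 0))]
  simp only [← Finset.mul_sum, inDeg_cast, outDeg_cast, Finset.sum_sub_distrib, mul_sub]

theorem outDeg_gt_fin {W : Type*} [Fintype W] {n : ℕ} (π : W ≃ Fin n) (v : W) :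
    outDeg (fun a b => π b < π a) v = π v := by
  classical
  rw [outDeg, ← Fin.card_Iio (π v), ← Finset.card_map π.toEmbedding]
  congr 1
  ext i
  simp only [Finset.mem_map_equiv, Finset.mem_filter, Finset.mem_univ, true_and, Finset.mem_Iio,
    Equiv.apply_symm_apply]

theorem inDeg_gt_fin {W : Type*} [Fintype W] {n : ℕ} (π : W ≃ Fin n) (v : W) :
    inDeg (fun a b => π b < π a) v = n - 1 - π v := by
  classical
  rw [inDeg, outDeg, ← Fin.card_Ioi (π v), ← Finset.card_map π.toEmbedding]
  congr 1
  ext i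
  simp only [Finset.mem_map_equiv, Finset.mem_filter, Finset.mem_univ, true_and, Finset.mem_Ioi,
    Equiv.apply_symm_apply]

theorem exists_equiv_fin_monotone {W : Type*} [Fintype W] (f : W → ℤ) :
    ∃ π : W ≃ Fin (Fintype.card W), ∀ u v, π u < π v → f u ≤ f v := by
  classical
  let e := Fintype.equivFin W
  refine ⟨e.trans (Tuple.sort (f ∘ e.symm)).symm, fun u v h => ?_⟩
  have := Tuple.monotone_sort (f ∘ e.symm) h.le
  simpa using this

/-- Among the digraphs in which every vertex lies on `n - 1` arcs (loops count twice), the strict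
linear orders are those with the largest sum of squared out-degrees. For a bijection `π` that sorts
the vertices by out-degree `f`, summing `f u - f v` over the arcs and over all pairs with
`π v < π u` gives `∑ f² ≤ ∑ f π`, so that `∑ f² ≥ ∑ π²` forces `f = π`. -/
theorem isStrictTotalOrder_of_sum_sq_outDeg {W : Type*} [Fintype W] (R : W → W → Prop)
    (hdeg : ∀ v, outDeg R v + inDeg R v + 1 = Fintype.card W)
    (hsq : ∑ i ∈ Finset.range (Fintype.card W), i ^ 2 ≤ ∑ v, outDeg R v ^ 2) :
    IsStrictTotalOrder W R := by
  classical
  set n := Fintype.card W with hn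
  set f : W → ℤ := fun v => outDeg R v with hf
  obtain ⟨π, hπ⟩ : ∃ π : W ≃ Fin n, ∀ u v, π u < π v → f u ≤ f v := exists_equiv_fin_monotone f
  set p : W → ℤ := fun v => ((π v : ℕ) : ℤ) with hp
  have hout : ∀ v, (outDeg R v : ℤ) = f v := fun v => rfl
  have hin : ∀ v, (inDeg R v : ℤ) = n - 1 - f v := fun v => by
    have := hdeg v
    simp only [hf]; omega
  have hterm : ∀ u v, (if R u v then f u - f v else 0) ≤
      (if π v < π u then f u - f v else 0) := by
    intro u v
    by_cases h : π v < π u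
    · have := hπ _ _ h
      rw [if_pos h]; split_ifs <;> omega
    · rw [if_neg h]
      split_ifs with hR
      · rcases (not_lt.1 h).lt_or_eq with h' | h'
        · have := hπ _ _ h'; omega
        · rw [π.injective h', sub_self]
      · rfl
  have hpin : ∀ v, (inDeg (fun a b => π b < π a) v : ℤ) = n - 1 - p v := fun v => by
    rw [inDeg_gt_fin]
    have := (π v).2
    simp only [hp]; omega
  have hpout : ∀ v, (outDeg (fun a b => π b < π a) v : ℤ) = p v := fun v => by
    rw [outDeg_gt_fin]
  -- Both sums are evaluated by degrees, which gives `∑ f² ≤ ∑ f π`.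
  have hle := Finset.sum_le_sum fun u (_ : u ∈ Finset.univ) =>
    Finset.sum_le_sum fun v (_ : v ∈ Finset.univ) => hterm u v
  rw [sum_arcs_sub, sum_arcs_sub (fun a b => π b < π a)] at hle
  simp only [hin, hout, hpin, hpout] at hle
  have hsq' : ∑ v, p v ^ 2 ≤ ∑ v, f v ^ 2 := by
    have h1 : ∑ v, p v ^ 2 = ∑ i : Fin n, ((i : ℕ) : ℤ) ^ 2 :=
      Equiv.sum_comp π (fun i : Fin n => ((i : ℕ) : ℤ) ^ 2)
    rw [h1, Fin.sum_univ_eq_sum_range (fun i : ℕ => (i : ℤ) ^ 2)]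
    simp only [hf]
    exact_mod_cast hsq
  have hfp : ∀ v, f v = p v := by
    have h1 : ∑ v, (f v - p v) ^ 2 ≤ 0 := by
      have h2 : ∑ v, (f v - p v) ^ 2 = (∑ v, p v ^ 2 - ∑ v, f v ^ 2) +
          (∑ v, f v * (f v - (n - 1 - f v)) - ∑ v, f v * (p v - (n - 1 - p v))) := by
        simp only [← Finset.sum_sub_distrib, ← Finset.sum_add_distrib]
        exact Finset.sum_congr rfl fun v _ => by ring
      omega
    have h2 := (Finset.sum_eq_zero_iff_of_nonneg fun v _ => sq_nonneg (f v - p v)).1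
      (le_antisymm h1 (Finset.sum_nonneg fun v _ => sq_nonneg _))
    intro v
    have := pow_eq_zero_iff (two_ne_zero) |>.1 (h2 v (Finset.mem_univ v))
    omega
  -- Equality of the two sums forces equality of all terms, which decides all arcs but the loops.
  have hoff : ∀ u v, u ≠ v → (R u v ↔ π v < π u) := by
    intro u v huv
    have heq : ∑ u, ∑ v, (if R u v then f u - f v else 0) =
        ∑ u, ∑ v, (if π v < π u then f u - f v else 0) := by
      rw [sum_arcs_sub, sum_arcs_sub (fun a b => π b < π a)]
      simp only [hin, hout, hpin, hpout, hfp]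
    have h1 := (Finset.sum_eq_sum_iff_of_le fun u (_ : u ∈ Finset.univ) =>
      Finset.sum_le_sum fun v (_ : v ∈ Finset.univ) => hterm u v).1 heq u (Finset.mem_univ u)
    have h2 := (Finset.sum_eq_sum_iff_of_le fun v (_ : v ∈ Finset.univ) => hterm u v).1 h1 v
      (Finset.mem_univ v)
    have h3 : f u - f v ≠ 0 := by
      rw [hfp, hfp]
      intro h0
      exact huv (π.injective (Fin.ext (by simp only [hp] at h0; omega)))
    by_cases hR : R u v <;> by_cases hlt : π v < π u <;> simp_all
  -- A loop at `u` would be an arc beyond the `π u = f u` arcs to the vertices below `u`.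
  have hirr : ∀ u, ¬ R u u := by
    intro u hu
    have h1 : (Finset.univ.filter fun w => π w < π u) ⊂ Finset.univ.filter fun w => R u w := by
      refine Finset.ssubset_iff_of_subset (fun w hw => ?_) |>.2 ⟨u, by simp [hu], by simp⟩
      simp only [Finset.mem_filter, Finset.mem_univ, true_and] at hw ⊢
      exact (hoff u w (by rintro rfl; exact lt_irrefl _ hw)).2 hw
    have h2 := Finset.card_lt_card h1
    have h3 : (outDeg (fun a b => π b < π a) u : ℤ) < f u := by
      simp only [hf, outDeg]
      exact_mod_cast h2
    rw [hpout, hfp] at h3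
    exact lt_irrefl _ h3
  have hR : ∀ u v, R u v ↔ π v < π u := fun u v => by
    by_cases h : u = v
    · subst h; simp [hirr]
    · exact hoff u v h
  exact
    { irrefl := hirr
      trans := fun a b c hab hbc => (hR a c).2 (((hR b c).1 hbc).trans ((hR a b).1 hab))
      trichotomous := fun a b hab hba => by
        rw [hR, not_lt] at hab hba
        exact π.injective (le_antisymm hab hba) }

theorem exists_equiv_fin_gt {W : Type*} [Fintype W] (R : W → W → Prop)
    [IsStrictTotalOrder W R] :
    ∃ π : W ≃ Fin (Fintype.card W), R = fun a b => π b < π a := by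
  classical
  let _ := linearOrderOfSTO R
  let e : W ≃o Fin (Fintype.card W) := (Fintype.orderIsoFinOfCardEq W rfl).symm
  refine ⟨e.toEquiv.trans Fin.revPerm, ?_⟩
  funext a b
  simp only [Equiv.trans_apply, Fin.revPerm_apply, Fin.rev_lt_rev, eq_iff_iff]
  exact (e.lt_iff_lt (x := a) (y := b)).symm

theorem IsStrictTotalOrder.outDeg_add_inDeg {W : Type*} [Fintype W] (R : W → W → Prop)
    [IsStrictTotalOrder W R] (v : W) : outDeg R v + inDeg R v + 1 = Fintype.card W := by
  obtain ⟨π, hπ⟩ := exists_equiv_fin_gt R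
  rw [hπ, outDeg_gt_fin, inDeg_gt_fin]
  have := (π v).2
  omega

theorem IsStrictTotalOrder.sum_sq_outDeg {W : Type*} [Fintype W] (R : W → W → Prop)
    [IsStrictTotalOrder W R] :
    ∑ v, outDeg R v ^ 2 = ∑ i ∈ Finset.range (Fintype.card W), i ^ 2 := by
  obtain ⟨π, hπ⟩ := exists_equiv_fin_gt R
  rw [hπ, ← Fin.sum_univ_eq_sum_range (fun i => i ^ 2)]
  simp only [outDeg_gt_fin]
  exact Equiv.sum_comp π (fun i => (i : ℕ) ^ 2)

open Classical in
theorem sum_outDeg_eq_sum_inDeg {W : Type*} [Fintype W] (R : W → W → Prop) :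
    ∑ v, outDeg R v = ∑ v, inDeg R v := by
  simp only [outDeg, inDeg, Finset.card_filter]
  exact Finset.sum_comm

theorem six_mul_sum_sq (n : ℕ) :
    6 * ∑ i ∈ Finset.range n, i ^ 2 + 3 * n ^ 2 = 2 * n ^ 3 + n := by
  induction n with
  | zero => simp
  | succ k ih => rw [Finset.sum_range_succ]; nlinarith

/-! ### Counting terms and simple networks -/

/-- A family of natural numbers indexed by the vertices of finite 2-featured graphs. -/
abbrev VertexCount : Type (u + 1) :=
  ∀ (V : Type u) [Fintype V], FeaturedGraph 2 V → V → ℕ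

/-- Terms for natural numbers attached to vertices: Boolean features and constants, closed under
multiplication by constants, addition, truncated subtraction, and summation over the out-neighbours
or over all vertices. -/
inductive CountTerm : Type
  | feat (i : Fin 2)
  | const (c : ℕ)
  | smul (c : ℕ) (t : CountTerm)
  | add (s t : CountTerm)
  | sub (s t : CountTerm)
  | agg (t : CountTerm)
  | read (t : CountTerm)

/-- The value of a term at a vertex. -/
def CountTerm.eval : CountTerm → VertexCount.{u}
  | .feat i => fun _ _ G v => if G.feat v i = true then 1 else 0
  | .const c => fun _ _ _ _ => c
  | .smul c t => fun V _ G v => c * t.eval V G v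
  | .add s t => fun V _ G v => s.eval V G v + t.eval V G v
  | .sub s t => fun V _ G v => s.eval V G v - t.eval V G v
  | .agg t => fun V _ G v => ∑ w ∈ G.outNeighbors v, t.eval V G w
  | .read t => fun V _ G _ => ∑ w, t.eval V G w

/-- Appending a layer behind a sequence of layers. -/
def ACRLayers.snoc : {m n k : ℕ} → ACRLayers m n → ACRLayer n k → ACRLayers m k
  | _, _, _, .nil _, ℓ => .cons ℓ (.nil _)
  | _, _, _, .cons ℓ' rest, ℓ => .cons ℓ' (rest.snoc ℓ)

theorem ACRLayers.apply_snoc {d m n k : ℕ} {V : Type u} [Fintype V] (G : FeaturedGraph d V)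
    (ls : ACRLayers m n) (ℓ : ACRLayer n k) (f : V → Fin m → ℝ) :
    (ls.snoc ℓ).apply G f = ℓ.apply G (ls.apply G f) := by
  induction ls with
  | nil n => rfl
  | cons ℓ' rest ih => exact ih ℓ (ℓ'.apply G f)

theorem ACRLayers.IsSimple.snoc {m n k : ℕ} {ls : ACRLayers m n} {ℓ : ACRLayer n k}
    (hls : ls.IsSimple) (hℓ : ℓ.IsSimple) : (ls.snoc ℓ).IsSimple := by
  induction ls with
  | nil n => exact ⟨hℓ, trivial⟩
  | cons ℓ' rest ih => exact ⟨hls.1, ih hls.2 hℓ⟩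

/-- The simple layer with the given matrices and bias. -/
def simpleLayer {m n : ℕ} (A C R : Matrix (Fin m) (Fin n) ℝ) (b : Fin n → ℝ) : ACRLayer m n where
  comb x₁ x₂ x₃ := reluVec (x₁ ᵥ* A + x₂ ᵥ* C + x₃ ᵥ* R + b)
  agg M := M.sum
  read M := M.sum

theorem simpleLayer_isSimple {m n : ℕ} (A C R : Matrix (Fin m) (Fin n) ℝ) (b : Fin n → ℝ) :
    (simpleLayer A C R b).IsSimple :=
  ⟨⟨A, C, R, b, fun _ _ _ => rfl⟩, fun _ => rfl, fun _ => rfl⟩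

/-- The family of embeddings `F` is computed by a simple network. -/
def SimplyComputed {m : ℕ} (F : Fin m → VertexCount.{u}) : Prop :=
  ∃ ls : ACRLayers 2 m, ls.IsSimple ∧ ∀ (V : Type u) [Fintype V] (G : FeaturedGraph 2 V) (v : V)
    (i : Fin m), ls.apply G G.realFeat v i = F i V G v

theorem SimplyComputed.layer {m n : ℕ} {F : Fin m → VertexCount.{u}} (hF : SimplyComputed F)
    (A C R : Matrix (Fin m) (Fin n) ℝ) (b : Fin n → ℝ) (F' : Fin n → VertexCount.{u})
    (h : ∀ (V : Type u) [Fintype V] (G : FeaturedGraph 2 V) (v : V) (j : Fin n),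
      max 0 (∑ i, (F i V G v : ℝ) * A i j
        + ∑ i, (∑ w ∈ G.outNeighbors v, (F i V G w : ℝ)) * C i j
        + ∑ i, (∑ w, (F i V G w : ℝ)) * R i j + b j) = F' j V G v) :
    SimplyComputed F' := by
  obtain ⟨ls, hls, hval⟩ := hF
  refine ⟨ls.snoc (simpleLayer A C R b), hls.snoc (simpleLayer_isSimple A C R b), ?_⟩
  intro V _ G v j
  have hagg : ∀ (s : Finset V) (i : Fin m),
      (s.val.map (ls.apply G G.realFeat)).sum i = ∑ w ∈ s, (F i V G w : ℝ) := by
    intro s i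
    have : (s.val.map (ls.apply G G.realFeat)).sum = ∑ w ∈ s, ls.apply G G.realFeat w := rfl
    rw [this, Finset.sum_apply]
    exact Finset.sum_congr rfl fun w _ => hval V G w i
  rw [ACRLayers.apply_snoc, ← h V G v j]
  simp only [ACRLayer.apply, simpleLayer, reluVec, Pi.add_apply, Matrix.vecMul, dotProduct, hagg,
    hval]

/-- One coordinate can be added to a network: the value of the rectified linear unit on an affine
combination of the coordinates, of their sums over neighbours, and of their global sums. -/
theorem SimplyComputed.snoc {m : ℕ} {F : Fin m → VertexCount.{u}} (hF : SimplyComputed F)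
    (a c r : Fin m → ℝ) (b : ℝ) (g : VertexCount.{u})
    (h : ∀ (V : Type u) [Fintype V] (G : FeaturedGraph 2 V) (v : V),
      max 0 (∑ i, (F i V G v : ℝ) * a i
        + ∑ i, (∑ w ∈ G.outNeighbors v, (F i V G w : ℝ)) * c i
        + ∑ i, (∑ w, (F i V G w : ℝ)) * r i + b) = g V G v) :
    SimplyComputed (Fin.snoc F g : Fin (m + 1) → VertexCount.{u}) := by
  refine hF.layer
    (Matrix.of fun i => Fin.snoc (fun j => if i = j then 1 else 0) (a i))
    (Matrix.of fun i => Fin.snoc (fun _ => 0) (c i))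
    (Matrix.of fun i => Fin.snoc (fun _ => 0) (r i)) (Fin.snoc (fun _ => 0) b) _ ?_
  intro V _ G v j
  refine Fin.lastCases ?_ (fun j => ?_) j
  · simpa using h V G v
  · simp

/-- A network can be extended so as to compute a further term, without losing what it computes: each
new layer copies all coordinates, which are nonnegative, and adds one for the next subterm. -/
theorem CountTerm.exists_simplyComputed (t : CountTerm) {m : ℕ} (F : Fin m → VertexCount.{u})
    (hF : SimplyComputed F) (hfeat : ∀ i, (CountTerm.feat i).eval ∈ Set.range F) :
    ∃ (m' : ℕ) (F' : Fin m' → VertexCount.{u}), SimplyComputed F' ∧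
      Set.range F ⊆ Set.range F' ∧ t.eval ∈ Set.range F' := by
  have key : ∀ {m : ℕ} (F : Fin m → VertexCount.{u}) (g : VertexCount.{u}),
      SimplyComputed (Fin.snoc F g : Fin (m + 1) → VertexCount.{u}) →
      ∃ (m' : ℕ) (F' : Fin m' → VertexCount.{u}), SimplyComputed F' ∧
        Set.range F ⊆ Set.range F' ∧ g ∈ Set.range F' := by
    intro m F g h
    refine ⟨m + 1, _, h, ?_, ⟨Fin.last m, by simp⟩⟩
    rintro _ ⟨i, rfl⟩
    exact ⟨i.castSucc, by simp⟩
  induction t generalizing m F with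
  | feat i => exact ⟨m, F, hF, subset_rfl, hfeat i⟩
  | const c =>
    refine key F _ (hF.snoc 0 0 0 c _ fun V _ G v => ?_)
    simp [CountTerm.eval]
  | smul c t iht =>
    obtain ⟨m₁, F₁, h₁, hsub₁, i, hi⟩ := iht F hF hfeat
    obtain ⟨m₂, F₂, h₂, hsub₂, ht⟩ := key F₁ (CountTerm.smul c t).eval
      (h₁.snoc (Pi.single i c) 0 0 0 _ fun V _ G v => by
        simp [Pi.single_apply, hi, CountTerm.eval, mul_comm]
        positivity)
    exact ⟨m₂, F₂, h₂, hsub₁.trans hsub₂, ht⟩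
  | add s t ihs iht =>
    obtain ⟨m₁, F₁, h₁, hsub₁, hs⟩ := ihs F hF hfeat
    obtain ⟨m₂, F₂, h₂, hsub₂, i, hi⟩ := iht F₁ h₁ fun i => hsub₁ (hfeat i)
    obtain ⟨j, hj⟩ := hsub₂ hs
    obtain ⟨m₃, F₃, h₃, hsub₃, hst⟩ := key F₂ (CountTerm.add s t).eval
      (h₂.snoc (Pi.single j 1 + Pi.single i 1) 0 0 0 _ fun V _ G v => by
        simp [mul_add, Finset.sum_add_distrib, Pi.single_apply, hi, hj, CountTerm.eval]
        positivity)
    exact ⟨m₃, F₃, h₃, (hsub₁.trans hsub₂).trans hsub₃, hst⟩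
  | sub s t ihs iht =>
    obtain ⟨m₁, F₁, h₁, hsub₁, hs⟩ := ihs F hF hfeat
    obtain ⟨m₂, F₂, h₂, hsub₂, i, hi⟩ := iht F₁ h₁ fun i => hsub₁ (hfeat i)
    obtain ⟨j, hj⟩ := hsub₂ hs
    obtain ⟨m₃, F₃, h₃, hsub₃, hst⟩ := key F₂ (CountTerm.sub s t).eval
      (h₂.snoc (Pi.single j 1 - Pi.single i 1) 0 0 0 _ fun V _ G v => by
        -- the rectified linear unit is truncated subtraction
        have : ∀ x y : ℕ, max 0 ((x : ℝ) - y) = ((x - y : ℕ) : ℝ) := fun x y => by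
          rcases le_total x y with h | h
          · rw [Nat.sub_eq_zero_of_le h, max_eq_left (by simpa using h), Nat.cast_zero]
          · rw [Nat.cast_sub h, max_eq_right (by simpa using h)]
        simpa [mul_sub, Finset.sum_sub_distrib, Pi.single_apply, hi, hj, CountTerm.eval]
          using this _ _)
    exact ⟨m₃, F₃, h₃, (hsub₁.trans hsub₂).trans hsub₃, hst⟩
  | agg t iht =>
    obtain ⟨m₁, F₁, h₁, hsub₁, i, hi⟩ := iht F hF hfeat
    obtain ⟨m₂, F₂, h₂, hsub₂, ht⟩ := key F₁ (CountTerm.agg t).eval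
      (h₁.snoc 0 (Pi.single i 1) 0 0 _ fun V _ G v => by
        simp [Pi.single_apply, hi, CountTerm.eval]
        positivity)
    exact ⟨m₂, F₂, h₂, hsub₁.trans hsub₂, ht⟩
  | read t iht =>
    obtain ⟨m₁, F₁, h₁, hsub₁, i, hi⟩ := iht F hF hfeat
    obtain ⟨m₂, F₂, h₂, hsub₂, ht⟩ := key F₁ (CountTerm.read t).eval
      (h₁.snoc 0 0 (Pi.single i 1) 0 _ fun V _ G v => by
        simp [Pi.single_apply, hi, CountTerm.eval]
        positivity)
    exact ⟨m₂, F₂, h₂, hsub₁.trans hsub₂, ht⟩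

/-- The vertices at which a term vanishes are recognised by a simple ACR-GNN. -/
theorem CountTerm.exists_isSimple (t : CountTerm) :
    ∃ N : ACRGNN 2, N.IsSimple ∧ ∀ (V : Type u) [Fintype V] (G : FeaturedGraph 2 V) (v : V),
      N.property V G v ↔ t.eval V G v = 0 := by
  obtain ⟨m, F, hF, -, i, hi⟩ := t.exists_simplyComputed
    (fun i => (CountTerm.feat i).eval : Fin 2 → VertexCount.{u})
    ⟨.nil 2, trivial, fun V _ G v i => by
      simp [ACRLayers.apply, FeaturedGraph.realFeat, CountTerm.eval]⟩
    fun i => ⟨i, rfl⟩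
  obtain ⟨ls, hls, hval⟩ := hF.layer (n := 1) (Matrix.of fun j _ => if j = i then 1 else 0) 0 0 0
    (fun _ => t.eval) fun V _ G v j => by simp [hi]
  refine ⟨⟨1, ls, fun x => decide (x 0 ≤ 0)⟩, ⟨hls, rfl, fun _ => -1, 0, fun x => ?_⟩,
    fun V _ G v => ?_⟩
  -- terms are nonnegative, so `t = 0` is the threshold condition `0 ≤ -t`
  · simp
  · simp [ACRGNN.property, hval]

/-! ### Local characterisation of gadgetisations -/

/-- The feature vector of the sources of a gadgetisation. -/
def sourceFeat : Fin 2 → Bool := ![true, false]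

/-- The feature vector of the sinks of a gadgetisation. -/
def sinkFeat : Fin 2 → Bool := ![false, true]

/-- The feature vector of the identity nodes of a gadgetisation. -/
def identFeat : Fin 2 → Bool := ![false, false]

namespace FeaturedGraph

variable {V : Type u}

/-- Every vertex with feature vector `κ` has exactly one out-neighbour with feature vector `κ'`. -/
def UniqueNeighbor (G : FeaturedGraph 2 V) (κ κ' : Fin 2 → Bool) : Prop :=
  ∀ v, G.feat v = κ → ∃! w, G.Adj v w ∧ G.feat w = κ'

/-- The local conditions that characterise gadgetisations of digraphs among undirected graphs. -/
structure IsGadget (G : FeaturedGraph 2 V) : Prop where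
  feat_cases : ∀ v, G.feat v = sourceFeat ∨ G.feat v = sinkFeat ∨ G.feat v = identFeat
  feat_ne : ∀ v w, G.Adj v w → G.feat v ≠ G.feat w
  source_ident : G.UniqueNeighbor sourceFeat identFeat
  sink_ident : G.UniqueNeighbor sinkFeat identFeat
  ident_source : G.UniqueNeighbor identFeat sourceFeat
  ident_sink : G.UniqueNeighbor identFeat sinkFeat

/-- In a gadgetisation, the relation between identity nodes that is given by the arcs. -/
def GadgetArc (G : FeaturedGraph 2 V) (i j : V) : Prop :=
  ∃ s t, G.feat s = sourceFeat ∧ G.feat t = sinkFeat ∧ G.Adj i s ∧ G.Adj j t ∧ G.Adj s t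

/-- The digraph on the identity nodes whose gadgetisation is the given graph. -/
def gadgetDigraph (G : FeaturedGraph 2 V) : Digraph {i // G.feat i = identFeat} where
  Adj i j := G.GadgetArc i j

theorem IsGadget.isomorphic {G : FeaturedGraph 2 V} (h : G.IsGadget) (hG : G.IsUndirected) :
    G.Isomorphic G.gadgetDigraph.gadgetisation := by
  choose s hs hs' using h.ident_source
  choose t ht ht' using h.ident_sink
  simp only at hs ht hs' ht'
  let g : GadgetVertex {i // G.feat i = identFeat} → V
    | .source i => s i i.2
    | .sink i => t i i.2
    | .ident i => i
  have hfeat : ∀ x, G.gadgetDigraph.gadgetisation.feat x = G.feat (g x) := by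
    rintro (i | i | i)
    · exact (hs i i.2).2.symm
    · exact (ht i i.2).2.symm
    · exact i.2.symm
  have hadj_source : ∀ i j : {i // G.feat i = identFeat}, G.Adj (s i i.2) j → i = j := by
    intro i j hij
    obtain ⟨w, -, hw⟩ := h.source_ident _ (hs i i.2).2
    exact Subtype.ext ((hw i ⟨hG _ _ (hs i i.2).1, i.2⟩).trans (hw j ⟨hij, j.2⟩).symm)
  have hadj_sink : ∀ i j : {i // G.feat i = identFeat}, G.Adj (t i i.2) j → i = j := by
    intro i j hij
    obtain ⟨w, -, hw⟩ := h.sink_ident _ (ht i i.2).2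
    exact Subtype.ext ((hw i ⟨hG _ _ (ht i i.2).1, i.2⟩).trans (hw j ⟨hij, j.2⟩).symm)
  have harc : ∀ i j : {i // G.feat i = identFeat},
      G.gadgetDigraph.Adj i j ↔ G.Adj (s i i.2) (t j j.2) := by
    intro i j
    constructor
    · rintro ⟨a, b, ha, hb, hia, hjb, hab⟩
      rwa [← hs' i i.2 a ⟨hia, ha⟩, ← ht' j j.2 b ⟨hjb, hb⟩]
    · intro hst
      exact ⟨_, _, (hs i i.2).2, (ht j j.2).2, (hs i i.2).1, (ht j j.2).1, hst⟩
  have hinj : Function.Injective g := by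
    intro x y hxy
    have hk := (hfeat x).trans ((congrArg G.feat hxy).trans (hfeat y).symm)
    rcases x with i | i | i <;> rcases y with j | j | j
    case source.source =>
      exact congrArg _ (hadj_source i j (by
        have : s i i.2 = s j j.2 := hxy
        rw [this]; exact hG _ _ (hs j j.2).1))
    case sink.sink =>
      exact congrArg _ (hadj_sink i j (by
        have : t i i.2 = t j j.2 := hxy
        rw [this]; exact hG _ _ (ht j j.2).1))
    case ident.ident => exact congrArg _ (Subtype.ext hxy)
    all_goals exact absurd hk (by simp [Digraph.gadgetisation])
  have hsurj : Function.Surjective g := by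
    intro v
    rcases h.feat_cases v with hv | hv | hv
    · obtain ⟨i, ⟨hvi, hi⟩, -⟩ := h.source_ident v hv
      exact ⟨.source ⟨i, hi⟩, (hs' i hi v ⟨hG _ _ hvi, hv⟩).symm⟩
    · obtain ⟨i, ⟨hvi, hi⟩, -⟩ := h.sink_ident v hv
      exact ⟨.sink ⟨i, hi⟩, (ht' i hi v ⟨hG _ _ hvi, hv⟩).symm⟩
    · exact ⟨.ident ⟨v, hv⟩, rfl⟩
  have hadj : ∀ x y, G.Adj (g x) (g y) ↔ G.gadgetDigraph.gadgetisation.Adj x y := by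
    intro x y
    have hne : G.Adj (g x) (g y) →
        G.gadgetDigraph.gadgetisation.feat x ≠ G.gadgetDigraph.gadgetisation.feat y := by
      rw [hfeat, hfeat]; exact h.feat_ne _ _
    rcases x with i | i | i <;> rcases y with j | j | j
    case source.sink => exact (harc i j).symm
    case sink.source =>
      exact ⟨fun hst => (harc j i).2 (hG _ _ hst), fun hst => hG _ _ ((harc j i).1 hst)⟩
    case source.ident =>
      exact ⟨hadj_source i j, by rintro (rfl : i = j); exact hG _ _ (hs i i.2).1⟩
    case ident.source =>
      exact ⟨fun hij => hadj_source j i (hG _ _ hij), by rintro (rfl : j = i); exact (hs _ _).1⟩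
    case sink.ident =>
      exact ⟨fun hij => (hadj_sink i j hij).symm,
        by rintro (rfl : j = i); exact hG _ _ (ht _ _).1⟩
    case ident.sink =>
      exact ⟨fun hij => (hadj_sink j i (hG _ _ hij)).symm,
        by rintro (rfl : i = j); exact (ht _ _).1⟩
    all_goals exact ⟨fun hxy => hne hxy rfl, False.elim⟩
  let e := Equiv.ofBijective g ⟨hinj, hsurj⟩
  refine ⟨e.symm, fun v w => ?_, fun v => ?_⟩
  · rw [← hadj]
    exact iff_of_eq (congrArg₂ G.Adj (e.apply_symm_apply v) (e.apply_symm_apply w)).symm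
  · rw [hfeat]
    exact congrArg G.feat (e.apply_symm_apply v).symm

theorem isGadget_gadgetisation {W : Type u} (D : Digraph W) : D.gadgetisation.IsGadget where
  feat_cases := by
    rintro (i | i | i)
    · exact .inl rfl
    · exact .inr (.inl rfl)
    · exact .inr (.inr rfl)
  feat_ne := by
    rintro (i | i | i) (j | j | j) h <;> first | exact h.elim | simp [Digraph.gadgetisation]
  source_ident := by
    rintro (i | i | i) h <;> simp [Digraph.gadgetisation, sourceFeat] at h
    refine ⟨.ident i, ⟨rfl, rfl⟩, ?_⟩
    rintro (j | j | j) ⟨h1, h2⟩ <;> simp [Digraph.gadgetisation, identFeat] at h1 h2 ⊢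
    exact h1.symm
  sink_ident := by
    rintro (i | i | i) h <;> simp [Digraph.gadgetisation, sinkFeat] at h
    refine ⟨.ident i, ⟨rfl, rfl⟩, ?_⟩
    rintro (j | j | j) ⟨h1, h2⟩ <;> simp [Digraph.gadgetisation, identFeat] at h1 h2 ⊢
    exact h1
  ident_source := by
    rintro (i | i | i) h <;> simp [Digraph.gadgetisation, identFeat] at h
    refine ⟨.source i, ⟨rfl, rfl⟩, ?_⟩
    rintro (j | j | j) ⟨h1, h2⟩ <;> simp [Digraph.gadgetisation, sourceFeat] at h1 h2 ⊢
    exact h1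
  ident_sink := by
    rintro (i | i | i) h <;> simp [Digraph.gadgetisation, identFeat] at h
    refine ⟨.sink i, ⟨rfl, rfl⟩, ?_⟩
    rintro (j | j | j) ⟨h1, h2⟩ <;> simp [Digraph.gadgetisation, sinkFeat] at h1 h2 ⊢
    exact h1.symm

theorem gadgetArc_gadgetisation {W : Type u} (D : Digraph W) (i j : W) :
    D.gadgetisation.GadgetArc (.ident i) (.ident j) ↔ D.Adj i j := by
  constructor
  · rintro ⟨(s | s | s), (t | t | t), h1, h2, h3, h4, h5⟩ <;>
      simp [Digraph.gadgetisation, sourceFeat, sinkFeat] at h1 h2 h3 h4 h5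
    subst h3 h4
    exact h5
  · exact fun h => ⟨.source i, .sink j, rfl, rfl, rfl, rfl, h⟩

theorem UniqueNeighbor.of_equiv {V' : Type u} {G : FeaturedGraph 2 V} {G' : FeaturedGraph 2 V'}
    (e : V ≃ V') (hadj : ∀ v w, G.Adj v w ↔ G'.Adj (e v) (e w))
    (hfeat : ∀ v, G.feat v = G'.feat (e v)) {κ κ' : Fin 2 → Bool}
    (h : G'.UniqueNeighbor κ κ') : G.UniqueNeighbor κ κ' := by
  intro v hv
  obtain ⟨w, hw, huniq⟩ := h (e v) (hfeat v ▸ hv)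
  refine ⟨e.symm w, by simpa [hadj, hfeat] using hw, fun y hy => ?_⟩
  rw [← huniq (e y) (by simpa [hadj, hfeat] using hy), e.symm_apply_apply]

theorem IsGadget.of_equiv {V' : Type u} {G : FeaturedGraph 2 V} {G' : FeaturedGraph 2 V'}
    (e : V ≃ V') (hadj : ∀ v w, G.Adj v w ↔ G'.Adj (e v) (e w))
    (hfeat : ∀ v, G.feat v = G'.feat (e v)) (h : G'.IsGadget) : G.IsGadget where
  feat_cases v := by rw [hfeat]; exact h.feat_cases _
  feat_ne v w hvw := by rw [hfeat, hfeat]; exact h.feat_ne _ _ ((hadj v w).1 hvw)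
  source_ident := h.source_ident.of_equiv e hadj hfeat
  sink_ident := h.sink_ident.of_equiv e hadj hfeat
  ident_source := h.ident_source.of_equiv e hadj hfeat
  ident_sink := h.ident_sink.of_equiv e hadj hfeat

theorem GadgetArc.iff_of_equiv {V' : Type u} {G : FeaturedGraph 2 V} {G' : FeaturedGraph 2 V'}
    (e : V ≃ V') (hadj : ∀ v w, G.Adj v w ↔ G'.Adj (e v) (e w))
    (hfeat : ∀ v, G.feat v = G'.feat (e v)) (i j : V) :
    G.GadgetArc i j ↔ G'.GadgetArc (e i) (e j) := by
  simp only [GadgetArc, hadj, hfeat, e.surjective.exists]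

/-- The conditions on an undirected graph, all of them first-order, that make it the gadgetisation
of a strict linear order. -/
structure IsGadgetOrder (G : FeaturedGraph 2 V) : Prop extends G.IsGadget where
  irrefl : ∀ i, G.feat i = identFeat → ¬ G.GadgetArc i i
  trans : ∀ i j k, G.feat i = identFeat → G.feat j = identFeat → G.feat k = identFeat →
    G.GadgetArc i j → G.GadgetArc j k → G.GadgetArc i k
  trichotomous : ∀ i j, G.feat i = identFeat → G.feat j = identFeat →
    ¬ G.GadgetArc i j → ¬ G.GadgetArc j i → i = j

theorem gadgetisedStrictLinearOrder_iff [Fintype V] {G : FeaturedGraph 2 V}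
    (hG : G.IsUndirected) (v : V) : gadgetisedStrictLinearOrder V G v ↔ G.IsGadgetOrder := by
  constructor
  · rintro ⟨W, D, hD, e, hadj, hfeat⟩
    have hident : ∀ i, G.feat i = identFeat → ∃ w, e i = .ident w := by
      intro i hi
      rw [hfeat] at hi
      rcases he : e i with w | w | w
      · exact absurd hi (by rw [he]; simp [Digraph.gadgetisation, identFeat])
      · exact absurd hi (by rw [he]; simp [Digraph.gadgetisation, identFeat])
      · exact ⟨w, rfl⟩
    have harc : ∀ {i j a b}, e i = .ident a → e j = .ident b → (G.GadgetArc i j ↔ D.Adj a b) := by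
      intro i j a b hi hj
      rw [GadgetArc.iff_of_equiv e hadj hfeat, hi, hj, gadgetArc_gadgetisation]
    refine ⟨(isGadget_gadgetisation D).of_equiv e hadj hfeat, fun i hi => ?_,
      fun i j k hi hj hk => ?_, fun i j hi hj => ?_⟩
    · obtain ⟨a, ha⟩ := hident i hi
      rw [harc ha ha]
      exact hD.irrefl a
    · obtain ⟨a, ha⟩ := hident i hi
      obtain ⟨b, hb⟩ := hident j hj
      obtain ⟨c, hc⟩ := hident k hk
      rw [harc ha hb, harc hb hc, harc ha hc]
      exact hD.trans a b c
    · obtain ⟨a, ha⟩ := hident i hi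
      obtain ⟨b, hb⟩ := hident j hj
      rw [harc ha hb, harc hb ha]
      intro h1 h2
      exact e.injective (by rw [ha, hb, hD.trichotomous a b h1 h2])
  · intro h
    exact ⟨_, G.gadgetDigraph,
      { irrefl := fun i => h.irrefl i i.2
        trans := fun i j k => h.trans i j k i.2 j.2 k.2
        trichotomous := fun i j h1 h2 => Subtype.ext (h.trichotomous i j i.2 j.2 h1 h2) },
      h.toIsGadget.isomorphic hG⟩

end FeaturedGraph

/-! ### The first-order formula -/

namespace FeaturedGraph
open FirstOrder Language

/-- Formulas with the bound variables `x₀, …, xₙ₋₁` (de Bruijn levels). -/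
abbrev FeaturedFormula (n : ℕ) : Type := (featuredLanguage 2).BoundedFormula (Fin 1) n

variable {V : Type u} {G : FeaturedGraph 2 V} {n : ℕ} {v : Fin 1 → V} {xs : Fin n → V}

/-- Satisfaction in the first-order structure of a graph. -/
def Sat (G : FeaturedGraph 2 V) (φ : FeaturedFormula n) (v : Fin 1 → V) (xs : Fin n → V) : Prop :=
  @BoundedFormula.Realize (featuredLanguage 2) V G.toStructure (Fin 1) n φ v xs

/-- The bound variable `xᵢ`. -/
def boundVar (i : Fin n) : (featuredLanguage 2).Term (Fin 1 ⊕ Fin n) := Term.var (Sum.inr i)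

/-- The formula stating that `xᵢ` and `xⱼ` are adjacent. -/
def adjFormula (i j : Fin n) : FeaturedFormula n :=
  Relations.boundedFormula₂ (L := featuredLanguage 2) FeaturedRel.edge (boundVar i) (boundVar j)

/-- The formula stating that `xᵢ = xⱼ`. -/
def eqFormula (i j : Fin n) : FeaturedFormula n := (boundVar i).bdEqual (boundVar j)

/-- The formula stating that `xᵢ` has feature vector `κ`. -/
def featFormula (κ : Fin 2 → Bool) (i : Fin n) : FeaturedFormula n :=
  let P (p : Fin 2) : FeaturedFormula n :=
    Relations.boundedFormula₁ (L := featuredLanguage 2) (FeaturedRel.feat p) (boundVar i)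
  (if κ 0 then P 0 else ∼(P 0)) ⊓ (if κ 1 then P 1 else ∼(P 1))

@[simp] theorem sat_adjFormula (i j : Fin n) :
    G.Sat (adjFormula i j) v xs ↔ G.Adj (xs i) (xs j) := by
  let _ := G.toStructure
  exact BoundedFormula.realize_rel₂

@[simp] theorem sat_eqFormula (i j : Fin n) : G.Sat (eqFormula i j) v xs ↔ xs i = xs j := by
  let _ := G.toStructure
  exact BoundedFormula.realize_bdEqual _ _

@[simp] theorem sat_inf (φ ψ : FeaturedFormula n) :
    G.Sat (φ ⊓ ψ) v xs ↔ G.Sat φ v xs ∧ G.Sat ψ v xs := by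
  let _ := G.toStructure
  exact BoundedFormula.realize_inf

@[simp] theorem sat_sup (φ ψ : FeaturedFormula n) :
    G.Sat (φ ⊔ ψ) v xs ↔ G.Sat φ v xs ∨ G.Sat ψ v xs := by
  let _ := G.toStructure
  exact BoundedFormula.realize_sup

@[simp] theorem sat_imp (φ ψ : FeaturedFormula n) :
    G.Sat (φ.imp ψ) v xs ↔ (G.Sat φ v xs → G.Sat ψ v xs) := by
  let _ := G.toStructure
  exact BoundedFormula.realize_imp

@[simp] theorem sat_not (φ : FeaturedFormula n) : G.Sat (∼φ) v xs ↔ ¬ G.Sat φ v xs := by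
  let _ := G.toStructure
  exact BoundedFormula.realize_not

@[simp] theorem sat_all (φ : FeaturedFormula (n + 1)) :
    G.Sat φ.all v xs ↔ ∀ a, G.Sat φ v (Fin.snoc xs a) := by
  let _ := G.toStructure
  exact BoundedFormula.realize_all

@[simp] theorem sat_ex (φ : FeaturedFormula (n + 1)) :
    G.Sat φ.ex v xs ↔ ∃ a, G.Sat φ v (Fin.snoc xs a) := by
  let _ := G.toStructure
  exact BoundedFormula.realize_ex

@[simp] theorem sat_featFormula (κ : Fin 2 → Bool) (i : Fin n) :
    G.Sat (featFormula κ i) v xs ↔ G.feat (xs i) = κ := by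
  have hP : ∀ p : Fin 2, G.Sat (Relations.boundedFormula₁ (L := featuredLanguage 2)
      (FeaturedRel.feat p) (boundVar i)) v xs ↔ G.feat (xs i) p = true := fun p => by
    let _ := G.toStructure
    exact BoundedFormula.realize_rel₁
  rw [funext_iff, Fin.forall_fin_two, featFormula, sat_inf]
  refine and_congr ?_ ?_ <;> split_ifs with h <;> simp [h, hP]

/-- The formula for `FeaturedGraph.UniqueNeighbor`. -/
def uniqueNeighborFormula (κ κ' : Fin 2 → Bool) : FeaturedFormula 0 :=
  ((featFormula κ 0).imp ((adjFormula 0 1 ⊓ featFormula κ' 1) ⊓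
    ((adjFormula 0 2 ⊓ featFormula κ' 2).imp (eqFormula 2 1)).all).ex).all

theorem sat_uniqueNeighborFormula (κ κ' : Fin 2 → Bool) (xs : Fin 0 → V) :
    G.Sat (uniqueNeighborFormula κ κ') v xs ↔ G.UniqueNeighbor κ κ' := by
  simp [uniqueNeighborFormula, UniqueNeighbor, Fin.snoc, ExistsUnique]

/-- The formula for `FeaturedGraph.GadgetArc`. -/
def arcFormula (i j : Fin n) : FeaturedFormula n :=
  let s : Fin (n + 2) := (Fin.last n).castSucc
  let t : Fin (n + 2) := Fin.last (n + 1)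
  (featFormula sourceFeat s ⊓ (featFormula sinkFeat t ⊓ (adjFormula i.castSucc.castSucc s ⊓
    (adjFormula j.castSucc.castSucc t ⊓ adjFormula s t)))).ex.ex

@[simp] theorem sat_arcFormula (i j : Fin n) :
    G.Sat (arcFormula i j) v xs ↔ G.GadgetArc (xs i) (xs j) := by
  simp [arcFormula, GadgetArc]

/-- The formula for `FeaturedGraph.IsGadgetOrder`. -/
def gadgetOrderFormula : FeaturedFormula 0 :=
  (featFormula sourceFeat 0 ⊔ (featFormula sinkFeat 0 ⊔ featFormula identFeat 0)).all ⊓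
  (((adjFormula 0 1).imp
    (∼(featFormula sourceFeat 0 ⊓ featFormula sourceFeat 1) ⊓
      (∼(featFormula sinkFeat 0 ⊓ featFormula sinkFeat 1) ⊓
        ∼(featFormula identFeat 0 ⊓ featFormula identFeat 1)))).all.all ⊓
  (uniqueNeighborFormula sourceFeat identFeat ⊓
  (uniqueNeighborFormula sinkFeat identFeat ⊓
  (uniqueNeighborFormula identFeat sourceFeat ⊓
  (uniqueNeighborFormula identFeat sinkFeat ⊓
  (((featFormula identFeat 0).imp (∼(arcFormula 0 0))).all ⊓
  (((featFormula identFeat 0).imp ((featFormula identFeat 1).imp ((featFormula identFeat 2).imp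
    ((arcFormula 0 1).imp ((arcFormula 1 2).imp (arcFormula 0 2)))))).all.all.all ⊓
  ((featFormula identFeat 0).imp ((featFormula identFeat 1).imp
    ((∼(arcFormula 0 1)).imp ((∼(arcFormula 1 0)).imp (eqFormula 0 1))))).all.all)))))))

theorem sat_gadgetOrderFormula (xs : Fin 0 → V) :
    G.Sat gadgetOrderFormula v xs ↔ G.IsGadgetOrder := by
  simp only [gadgetOrderFormula, sat_inf, sat_uniqueNeighborFormula]
  simp only [sat_all, sat_imp, sat_sup, sat_inf, sat_not, sat_featFormula, sat_adjFormula,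
    sat_arcFormula, sat_eqFormula]
  simp only [Fin.snoc]
  constructor
  · rintro ⟨h1, h2, h3, h4, h5, h6, h7, h8, h9⟩
    refine ⟨⟨h1, fun v w hvw he => ?_, h3, h4, h5, h6⟩, h7, h8, h9⟩
    obtain ⟨hs, ht, hi⟩ := h2 v w hvw
    rcases h1 v with hv | hv | hv
    · exact hs ⟨hv, he ▸ hv⟩
    · exact ht ⟨hv, he ▸ hv⟩
    · exact hi ⟨hv, he ▸ hv⟩
  · rintro ⟨⟨h1, h2, h3, h4, h5, h6⟩, h7, h8, h9⟩
    exact ⟨h1, fun v w hvw => ⟨fun h => h2 v w hvw (h.1.trans h.2.symm),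
      fun h => h2 v w hvw (h.1.trans h.2.symm), fun h => h2 v w hvw (h.1.trans h.2.symm)⟩,
      h3, h4, h5, h6, h7, h8, h9⟩

end FeaturedGraph

theorem property_gadgetOrderFormula (V : Type u) [Fintype V] (G : FeaturedGraph 2 V) (v : V) :
    FOClassifier.property FeaturedGraph.gadgetOrderFormula V G v ↔ G.IsGadgetOrder :=
  FeaturedGraph.sat_gadgetOrderFormula _

/-! ### Indistinguishability in two-variable counting logic -/

theorem Digraph.gadgetisation_isUndirected {W : Type u} (D : Digraph W) :
    D.gadgetisation.IsUndirected := by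
  rintro (i | i | i) (j | j | j) h <;> exact h

namespace GadgetVertex

variable {W : Type u}

/-- A gadgetisation has three vertices for each vertex of the digraph. -/
def equivSum (W : Type u) : GadgetVertex W ≃ W ⊕ W ⊕ W where
  toFun
    | .source w => .inl w
    | .sink w => .inr (.inl w)
    | .ident w => .inr (.inr w)
  invFun
    | .inl w => .source w
    | .inr (.inl w) => .sink w
    | .inr (.inr w) => .ident w
  left_inv := by rintro (w | w | w) <;> rfl
  right_inv := by rintro (w | w | w) <;> rfl

instance [Fintype W] : Fintype (GadgetVertex W) := Fintype.ofEquiv _ (equivSum W).symm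

/-- The vertex of the digraph to which a vertex of the gadgetisation belongs. -/
def base : GadgetVertex W → W
  | .source w => w
  | .sink w => w
  | .ident w => w

/-- The action of permutations of the digraph's vertices on the vertices of the gadgetisation. -/
def congr (e : W ≃ W) : GadgetVertex W ≃ GadgetVertex W where
  toFun
    | .source w => .source (e w)
    | .sink w => .sink (e w)
    | .ident w => .ident (e w)
  invFun
    | .source w => .source (e.symm w)
    | .sink w => .sink (e.symm w)
    | .ident w => .ident (e.symm w)
  left_inv := by rintro (w | w | w) <;> simp
  right_inv := by rintro (w | w | w) <;> simp

end GadgetVertex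

namespace C2Formula

/-- The nesting depth of quantifiers. -/
def depth {d : ℕ} : C2Formula d → ℕ
  | eq _ _ => 0
  | edge _ _ => 0
  | feat _ _ => 0
  | neg φ => φ.depth
  | and φ ψ => max φ.depth ψ.depth
  | existsGE _ _ φ => φ.depth + 1

/-- The largest threshold of a counting quantifier. -/
def threshold {d : ℕ} : C2Formula d → ℕ
  | eq _ _ => 0
  | edge _ _ => 0
  | feat _ _ => 0
  | neg φ => φ.threshold
  | and φ ψ => max φ.threshold ψ.threshold
  | existsGE k _ φ => max k φ.threshold

end C2Formula

/-- To compare counts up to a threshold `k`, it suffices to match each witness with a witness, or to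
find `k` witnesses on the other side. -/
theorem le_card_subtype_of_equiv {A B : Type*} [Finite A] [Finite B] {P : A → Prop} {Q : B → Prop}
    {k : ℕ} (e : A ≃ B) (h : ∀ a, P a → Q (e a) ∨ k ≤ Nat.card {b // Q b})
    (hk : k ≤ Nat.card {a // P a}) : k ≤ Nat.card {b // Q b} := by
  by_cases hQ : k ≤ Nat.card {b // Q b}
  · exact hQ
  · refine hk.trans (Nat.card_le_card_of_injective
      (fun a : {a // P a} => (⟨e a, (h a a.2).resolve_right hQ⟩ : {b // Q b})) ?_)
    intro a b hab
    exact Subtype.ext (e.injective (congrArg Subtype.val hab))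

/-- The positions `i < n` are told apart if they are among the first or the last `M`; all
positions in between get the same value `n`. -/
def positionType (n M i : ℕ) : ℕ := if i < M ∨ n ≤ i + M then i else n

theorem positionType_eq_iff {n M i j : ℕ} (hi : i < n) (hj : j < n) :
    positionType n M i = positionType n M j ↔
      i = j ∨ (M ≤ i ∧ i + M < n) ∧ (M ≤ j ∧ j + M < n) := by
  unfold positionType
  split_ifs <;> omega

section Game

variable {n : ℕ}

/-- The digraph agrees with the strict order of the positions `0, …, n - 1`, except perhaps for a
loop at `m`. -/
def IsOrderUpToLoop (m : ℕ) (D : Digraph (ULift.{u} (Fin n))) : Prop :=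
  ∀ i j : ULift.{u} (Fin n),
    ¬ ((i.down : ℕ) = m ∧ (j.down : ℕ) = m) → (D.Adj i j ↔ i.down < j.down)

/-- The pairs `(x, a)` and `(y, b)` have the same atomic type, given that `x` and `y` have the same
features, and `a` and `b` have the same position type. -/
structure PairMatch (D D' : Digraph (ULift.{u} (Fin n))) (M : ℕ)
    (x a y b : GadgetVertex (ULift.{u} (Fin n))) : Prop where
  feat : D.gadgetisation.feat a = D'.gadgetisation.feat b
  adj : D.gadgetisation.Adj x a ↔ D'.gadgetisation.Adj y b
  eq : x = a ↔ y = b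
  pos : positionType n M a.base.down = positionType n M b.base.down

theorem le_card_of_forall_Ico {Q : GadgetVertex (ULift.{u} (Fin n)) → Prop} {K l r : ℕ}
    (f : ULift.{u} (Fin n) → GadgetVertex (ULift.{u} (Fin n))) (hf : Function.Injective f)
    (hK : l + K ≤ r) (hr : r ≤ n)
    (hQ : ∀ i : ULift.{u} (Fin n), l ≤ (i.down : ℕ) → (i.down : ℕ) < r → Q (f i)) :
    K ≤ Nat.card {b // Q b} := by
  let g : Fin K → {b // Q b} := fun k =>
    ⟨f ⟨⟨l + k, by omega⟩⟩, hQ _ (by simp) (by simp only; omega)⟩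
  have := Nat.card_le_card_of_injective g fun a b hab => by
    have h1 := hf (congrArg Subtype.val hab)
    have h2 : l + (a : ℕ) = l + b := congrArg (fun z : ULift (Fin n) => (z.down : ℕ)) h1
    exact Fin.ext (by omega)
  simpa using this

/-- The move of the counting game. If `x` and `y` lie at the same exact position, the identity
matches the vertices; otherwise both positions are in the middle, and swapping them does, except
for the sinks (or sources) at middle positions, of which at least `K` are adjacent and at least `K`
are not adjacent to each of `x` and `y`. -/
theorem exists_equiv_pairMatch {m M K : ℕ} {D D' : Digraph (ULift.{u} (Fin n))}
    (hD : IsOrderUpToLoop m D) (hD' : IsOrderUpToLoop m D') (hm : M + K ≤ m)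
    (hmn : m + (M + K) < n) {x y : GadgetVertex (ULift.{u} (Fin n))}
    (hfeat : D.gadgetisation.feat x = D'.gadgetisation.feat y)
    (hpos : positionType n (M + K) x.base.down = positionType n (M + K) y.base.down) :
    ∃ e : GadgetVertex (ULift.{u} (Fin n)) ≃ GadgetVertex (ULift.{u} (Fin n)),
      ∀ a, PairMatch D D' M x a y (e a) ∨ K ≤ Nat.card {b // PairMatch D D' M x a y b} := by
  by_cases hxy : x.base = y.base ∧ (x.base.down : ℕ) ≠ m
  · obtain ⟨hb, hxm⟩ := hxy
    have hadj : ∀ j, (D.Adj x.base j ↔ D'.Adj x.base j) ∧ (D.Adj j x.base ↔ D'.Adj j x.base) :=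
      fun j => ⟨by rw [hD _ _ (by tauto), hD' _ _ (by tauto)],
        by rw [hD _ _ (by tauto), hD' _ _ (by tauto)]⟩
    have hx : x = y := by
      rcases x with i | i | i <;> rcases y with j | j | j <;>
        first | exact congrArg _ hb | simp [Digraph.gadgetisation] at hfeat
    subst hx
    refine ⟨Equiv.refl _, fun a => .inl ⟨?_, ?_, Iff.rfl, rfl⟩⟩
    · rcases a with j | j | j <;> rfl
    · rcases x with i | i | i <;> rcases a with j | j | j
      case source.sink => exact (hadj j).1
      case sink.source => exact (hadj j).2
      all_goals exact Iff.rfl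
  -- A vertex at the exceptional position `m` is treated as a middle one even if `x = y`, since the
  -- loop may be present in only one of the two graphs.
  · have hmid : (M + K ≤ (x.base.down : ℕ) ∧ (x.base.down : ℕ) + (M + K) < n) ∧
        (M + K ≤ (y.base.down : ℕ) ∧ (y.base.down : ℕ) + (M + K) < n) := by
      rcases (positionType_eq_iff x.base.down.2 y.base.down.2).1 hpos with h | h
      · have hb : x.base = y.base := ULift.ext _ _ (Fin.ext h)
        have hxm : (x.base.down : ℕ) = m := by tauto
        omega
      · exact h
    classical
    refine ⟨GadgetVertex.congr (Equiv.swap x.base y.base), fun a => ?_⟩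
    have hswap : ∀ j, Equiv.swap x.base y.base j = y.base ↔ j = x.base := fun j => by
      rw [Equiv.swap_apply_eq_iff, Equiv.swap_apply_right]
    have hswap_pos : ∀ j, positionType n M j.down =
        positionType n M (Equiv.swap x.base y.base j).down := fun j => by
      rw [positionType_eq_iff (Fin.isLt _) (Fin.isLt _)]
      by_cases h1 : j = x.base
      · rw [h1, Equiv.swap_apply_left]; omega
      · by_cases h2 : j = y.base
        · rw [h2, Equiv.swap_apply_right]; omega
        · rw [Equiv.swap_apply_of_ne_of_ne h1 h2]; exact .inl rfl
    -- Positions outside the middle are fixed by the swap and lie on the same side of `x` and `y`.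
    have hexact : ∀ j : ULift.{u} (Fin n), ¬ (M ≤ (j.down : ℕ) ∧ (j.down : ℕ) + M < n) →
        Equiv.swap x.base y.base j = j ∧ (D.Adj x.base j ↔ D'.Adj y.base j) ∧
          (D.Adj j x.base ↔ D'.Adj j y.base) := fun j hj => by
      refine ⟨Equiv.swap_apply_of_ne_of_ne ?_ ?_, ?_, ?_⟩
      · rintro rfl; omega
      · rintro rfl; omega
      · rw [hD _ _ (by omega), hD' _ _ (by omega), Fin.lt_def, Fin.lt_def]; omega
      · rw [hD _ _ (by omega), hD' _ _ (by omega), Fin.lt_def, Fin.lt_def]; omega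
    have hlt : ∀ {D : Digraph (ULift.{u} (Fin n))} {i j : ULift.{u} (Fin n)},
        IsOrderUpToLoop m D → (i.down : ℕ) < j.down → D.Adj i j ∧ ¬ D.Adj j i :=
      fun h hij => ⟨(h _ _ (by omega)).2 hij, fun h' => by
        have := (h _ _ (by omega)).1 h'
        rw [Fin.lt_def] at this; omega⟩
    rcases x with i | i | i <;> rcases y with i' | i' | i' <;>
      first
        | (exfalso; simp [Digraph.gadgetisation] at hfeat; done)
        | simp only [GadgetVertex.base] at *
    · rcases a with j | j | j
      · exact .inl ⟨rfl, Iff.rfl, by simpa [GadgetVertex.congr, eq_comm] using (hswap j).symm,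
          hswap_pos j⟩
      · by_cases hj : M ≤ (j.down : ℕ) ∧ (j.down : ℕ) + M < n
        · right
          by_cases hadj : D.Adj i j
          · refine le_card_of_forall_Ico (l := i'.down + 1) (r := n - M) .sink
              (fun _ _ h => by simpa using h) (by omega) (by omega) fun k hk hk' =>
              ⟨rfl, iff_of_true hadj (hlt hD' (by omega)).1, by simp, ?_⟩
            rw [positionType_eq_iff (Fin.isLt _) (Fin.isLt _)]
            simp only [GadgetVertex.base]; omega
          · refine le_card_of_forall_Ico (l := M) (r := i'.down) .sink
              (fun _ _ h => by simpa using h) (by omega) (by omega) fun k hk hk' =>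
              ⟨rfl, iff_of_false hadj (hlt hD' (by omega)).2, by simp, ?_⟩
            rw [positionType_eq_iff (Fin.isLt _) (Fin.isLt _)]
            simp only [GadgetVertex.base]; omega
        · refine .inl ⟨rfl, ?_, by simp [GadgetVertex.congr], hswap_pos j⟩
          obtain ⟨h1, h2, -⟩ := hexact j hj
          change D.Adj i j ↔ D'.Adj i' (Equiv.swap i i' j)
          rw [h1, h2]
      · refine .inl ⟨rfl, ?_, by simp [GadgetVertex.congr], hswap_pos j⟩
        change i = j ↔ i' = Equiv.swap i i' j
        rw [eq_comm, ← hswap, eq_comm]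
    · rcases a with j | j | j
      · by_cases hj : M ≤ (j.down : ℕ) ∧ (j.down : ℕ) + M < n
        · right
          by_cases hadj : D.Adj j i
          · refine le_card_of_forall_Ico (l := M) (r := i'.down) .source
              (fun _ _ h => by simpa using h) (by omega) (by omega) fun k hk hk' =>
              ⟨rfl, iff_of_true hadj (hlt hD' (by omega)).1, by simp, ?_⟩
            rw [positionType_eq_iff (Fin.isLt _) (Fin.isLt _)]
            simp only [GadgetVertex.base]; omega
          · refine le_card_of_forall_Ico (l := i'.down + 1) (r := n - M) .source
              (fun _ _ h => by simpa using h) (by omega) (by omega) fun k hk hk' =>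
              ⟨rfl, iff_of_false hadj (hlt hD' (by omega)).2, by simp, ?_⟩
            rw [positionType_eq_iff (Fin.isLt _) (Fin.isLt _)]
            simp only [GadgetVertex.base]; omega
        · refine .inl ⟨rfl, ?_, by simp [GadgetVertex.congr], hswap_pos j⟩
          obtain ⟨h1, -, h2⟩ := hexact j hj
          change D.Adj j i ↔ D'.Adj (Equiv.swap i i' j) i'
          rw [h1, h2]
      · exact .inl ⟨rfl, Iff.rfl, by simpa [GadgetVertex.congr, eq_comm] using (hswap j).symm,
          hswap_pos j⟩
      · refine .inl ⟨rfl, ?_, by simp [GadgetVertex.congr], hswap_pos j⟩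
        change j = i ↔ Equiv.swap i i' j = i'
        rw [hswap]
    · rcases a with j | j | j
      · refine .inl ⟨rfl, ?_, by simp [GadgetVertex.congr], hswap_pos j⟩
        change j = i ↔ Equiv.swap i i' j = i'
        rw [hswap]
      · refine .inl ⟨rfl, ?_, by simp [GadgetVertex.congr], hswap_pos j⟩
        change i = j ↔ i' = Equiv.swap i i' j
        rw [eq_comm, ← hswap, eq_comm]
      · exact .inl ⟨rfl, Iff.rfl, by simpa [GadgetVertex.congr, eq_comm] using (hswap j).symm,
          hswap_pos j⟩

/-- The assignments `σ` and `τ` of the two variables have the same atomic types and the same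
position types. -/
structure AssignmentMatch (D D' : Digraph (ULift.{u} (Fin n))) (M : ℕ)
    (σ τ : Fin 2 → GadgetVertex (ULift.{u} (Fin n))) : Prop where
  feat : ∀ i, D.gadgetisation.feat (σ i) = D'.gadgetisation.feat (τ i)
  adj : ∀ i j, D.gadgetisation.Adj (σ i) (σ j) ↔ D'.gadgetisation.Adj (τ i) (τ j)
  eq : ∀ i j, σ i = σ j ↔ τ i = τ j
  pos : ∀ i, positionType n M (σ i).base.down = positionType n M (τ i).base.down

theorem AssignmentMatch.symm {D D' : Digraph (ULift.{u} (Fin n))} {M : ℕ}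
    {σ τ : Fin 2 → GadgetVertex (ULift.{u} (Fin n))} (h : AssignmentMatch D D' M σ τ) :
    AssignmentMatch D' D M τ σ :=
  ⟨fun i => (h.feat i).symm, fun i j => (h.adj i j).symm, fun i j => (h.eq i j).symm,
    fun i => (h.pos i).symm⟩

theorem Digraph.gadgetisation_irrefl {W : Type u} (D : Digraph W) (x : GadgetVertex W) :
    ¬ D.gadgetisation.Adj x x := by
  rcases x with i | i | i <;> exact id

theorem positionType_mono {M M' i j : ℕ} (hM : M ≤ M') (hi : i < n) (hj : j < n)
    (h : positionType n M' i = positionType n M' j) : positionType n M i = positionType n M j := by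
  rw [positionType_eq_iff hi hj] at h ⊢
  omega

theorem AssignmentMatch.update {D D' : Digraph (ULift.{u} (Fin n))} {M K : ℕ}
    {σ τ : Fin 2 → GadgetVertex (ULift.{u} (Fin n))} (h : AssignmentMatch D D' (M + K) σ τ)
    {i o : Fin 2} (ho : o ≠ i) {a b : GadgetVertex (ULift.{u} (Fin n))}
    (hab : PairMatch D D' M (σ o) a (τ o) b) :
    AssignmentMatch D D' M (Function.update σ i a) (Function.update τ i b) := by
  have hcases : ∀ j : Fin 2, j = i ∨ j = o := by omega
  have hσ : Function.update σ i a o = σ o := Function.update_of_ne ho _ _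
  have hτ : Function.update τ i b o = τ o := Function.update_of_ne ho _ _
  have hadj : D.gadgetisation.Adj a (σ o) ↔ D'.gadgetisation.Adj b (τ o) :=
    ⟨fun h => D'.gadgetisation_isUndirected _ _
        (hab.adj.1 (D.gadgetisation_isUndirected _ _ h)),
      fun h => D.gadgetisation_isUndirected _ _
        (hab.adj.2 (D'.gadgetisation_isUndirected _ _ h))⟩
  refine ⟨fun j => ?_, fun j k => ?_, fun j k => ?_, fun j => ?_⟩
  · rcases hcases j with rfl | rfl
    · simpa using hab.feat
    · rw [hσ, hτ]; exact h.feat _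
  · rcases hcases j with rfl | rfl <;> rcases hcases k with rfl | rfl
    · simp [Digraph.gadgetisation_irrefl]
    · simpa [hσ, hτ] using hadj
    · simpa [hσ, hτ] using hab.adj
    · rw [hσ, hτ]; exact h.adj _ _
  · rcases hcases j with rfl | rfl <;> rcases hcases k with rfl | rfl
    · simp
    · simpa [hσ, hτ, eq_comm] using hab.eq
    · simpa [hσ, hτ] using hab.eq
    · simp
  · rcases hcases j with rfl | rfl
    · simpa using hab.pos
    · rw [hσ, hτ]
      exact positionType_mono (by omega) (Fin.isLt _) (Fin.isLt _) (h.pos _)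

/-- Formulas with thresholds at most `K` and depth at most `r` see at most `K * r` positions from
either end, so they do not notice a loop in the middle. -/
theorem AssignmentMatch.realize_iff {K m : ℕ} (φ : C2Formula 2) (hK : φ.threshold ≤ K) :
    ∀ {r : ℕ} {D D' : Digraph (ULift.{u} (Fin n))}
      {σ τ : Fin 2 → GadgetVertex (ULift.{u} (Fin n))}, φ.depth ≤ r → K * r ≤ m →
      m + K * r < n → IsOrderUpToLoop m D → IsOrderUpToLoop m D' →
      AssignmentMatch D D' (K * r) σ τ →
      (φ.Realize D.gadgetisation σ ↔ φ.Realize D'.gadgetisation τ) := by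
  induction φ with
  | eq i j => intro r D D' σ τ _ _ _ _ _ h; exact h.eq i j
  | edge i j => intro r D D' σ τ _ _ _ _ _ h; exact h.adj i j
  | feat p i =>
    intro r D D' σ τ _ _ _ _ _ h
    exact iff_of_eq (congrArg (fun κ : Fin 2 → Bool => κ p = true) (h.feat i))
  | neg φ ih =>
    intro r D D' σ τ hr h1 h2 hD hD' h
    exact not_congr (ih hK hr h1 h2 hD hD' h)
  | and φ ψ ihφ ihψ =>
    intro r D D' σ τ hr h1 h2 hD hD' h
    simp only [C2Formula.threshold, C2Formula.depth, max_le_iff] at hK hr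
    exact and_congr (ihφ hK.1 hr.1 h1 h2 hD hD' h) (ihψ hK.2 hr.2 h1 h2 hD hD' h)
  | existsGE k i φ ih =>
    simp only [C2Formula.threshold, max_le_iff] at hK
    suffices key : ∀ {r : ℕ} {D D' : Digraph (ULift.{u} (Fin n))}
        {σ τ : Fin 2 → GadgetVertex (ULift.{u} (Fin n))}, φ.depth + 1 ≤ r → K * r ≤ m →
        m + K * r < n → IsOrderUpToLoop m D → IsOrderUpToLoop m D' →
        AssignmentMatch D D' (K * r) σ τ →
        ((C2Formula.existsGE k i φ).Realize D.gadgetisation σ →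
          (C2Formula.existsGE k i φ).Realize D'.gadgetisation τ) by
      intro r D D' σ τ hr h1 h2 hD hD' h
      exact ⟨key hr h1 h2 hD hD' h, key hr h1 h2 hD' hD h.symm⟩
    intro r D D' σ τ hr h1 h2 hD hD' h hσ
    obtain ⟨r, rfl⟩ : ∃ r', r = r' + 1 := ⟨r - 1, by omega⟩
    rw [mul_add, mul_one] at h1 h2 h
    obtain ⟨o, ho⟩ := exists_ne i
    obtain ⟨e, he⟩ := exists_equiv_pairMatch hD hD' h1 h2 (h.feat o) (h.pos o)
    have hstep : ∀ {a b}, PairMatch D D' (K * r) (σ o) a (τ o) b →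
        φ.Realize D.gadgetisation (Function.update σ i a) →
        φ.Realize D'.gadgetisation (Function.update τ i b) := fun hab =>
      (ih hK.2 (by omega) (by omega) (by omega) hD hD' (h.update ho hab)).1
    refine le_card_subtype_of_equiv e (fun a ha => ?_) hσ
    rcases he a with hab | hcard
    · exact .inl (hstep hab ha)
    · refine .inr (hK.1.trans (hcard.trans (Nat.card_le_card_of_injective
        (fun b => ⟨b.1, hstep b.2 ha⟩) ?_)))
      intro b b' hbb
      exact Subtype.ext (Subtype.mk.inj hbb)

end Game

/-- With thresholds at most `K` and depth `r`, a classifier gives the same answer on the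
gadgetisation of the strict order of `2 * K * r + 1` positions and on the one with a loop added in
the centre. -/
theorem not_equivOverUndirected_c2Classifier (ψ : C2Classifier 2) :
    ¬ EquivOverUndirected gadgetisedStrictLinearOrder.{u} ψ.property := by
  intro hψ
  obtain ⟨K, hK⟩ : ∃ K, K = ψ.formula.threshold := ⟨_, rfl⟩
  obtain ⟨m, hm⟩ : ∃ m, m = K * ψ.formula.depth := ⟨_, rfl⟩
  let D : Digraph (ULift.{u} (Fin (2 * m + 1))) := ⟨fun i j => i.down < j.down⟩
  let D' : Digraph (ULift.{u} (Fin (2 * m + 1))) :=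
    ⟨fun i j => i.down < j.down ∨ (i.down : ℕ) = m ∧ (j.down : ℕ) = m⟩
  let c : ULift.{u} (Fin (2 * m + 1)) := ⟨⟨m, by omega⟩⟩
  have hD : IsOrderUpToLoop m D := fun i j _ => Iff.rfl
  have hD' : IsOrderUpToLoop m D' := fun i j h => or_iff_left h
  have hiff : ψ.property (GadgetVertex (ULift.{u} (Fin (2 * m + 1)))) D.gadgetisation (.source c) ↔
      ψ.property (GadgetVertex (ULift.{u} (Fin (2 * m + 1)))) D'.gadgetisation (.source c) :=
    AssignmentMatch.realize_iff ψ.formula hK.ge le_rfl hm.ge (by omega) hD hD'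
      ⟨fun _ => rfl, fun _ _ => Iff.rfl, fun _ _ => Iff.rfl, fun _ => rfl⟩
  rw [← hψ _ _ _ D.gadgetisation_isUndirected, ← hψ _ _ _ D'.gadgetisation_isUndirected,
    FeaturedGraph.gadgetisedStrictLinearOrder_iff D'.gadgetisation_isUndirected] at hiff
  have h := hiff.1 ⟨_, D,
    { irrefl := fun i => lt_irrefl i.down
      trans := fun i j k => lt_trans
      trichotomous := fun i j h1 h2 =>
        ULift.ext _ _ (le_antisymm (not_lt.1 h2) (not_lt.1 h1)) },
    Equiv.refl _, fun _ _ => Iff.rfl, fun _ => rfl⟩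
  exact h.irrefl (.ident c) rfl ((FeaturedGraph.gadgetArc_gadgetisation D' c c).2 (.inr ⟨rfl, rfl⟩))

/-! ### Recognising gadgetised orders by counting -/

namespace CountTerm

theorem eval_equiv (t : CountTerm) {V V' : Type u} [Fintype V] [Fintype V']
    {G : FeaturedGraph 2 V} {G' : FeaturedGraph 2 V'} (e : V ≃ V')
    (hadj : ∀ v w, G.Adj v w ↔ G'.Adj (e v) (e w)) (hfeat : ∀ v, G.feat v = G'.feat (e v)) (v : V) :
    t.eval V G v = t.eval V' G' (e v) := by
  classical
  induction t generalizing v with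
  | feat i => simp only [eval, hfeat]
  | const c => rfl
  | smul c t iht => simp only [eval, iht]
  | add s t ihs iht => simp only [eval, ihs, iht]
  | sub s t ihs iht => simp only [eval, ihs, iht]
  | agg t iht =>
    simp only [eval, FeaturedGraph.outNeighbors, Finset.sum_filter, iht, hadj]
    exact e.sum_comp fun w => if G'.Adj (e v) w then t.eval V' G' w else 0
  | read t iht =>
    simp only [eval, iht]
    exact e.sum_comp fun w => t.eval V' G' w

/-- The indicator of sources. -/
def isSource : CountTerm := sub (feat 0) (feat 1)

/-- The indicator of sinks. -/
def isSink : CountTerm := sub (feat 1) (feat 0)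

/-- The indicator of identity nodes. -/
def isIdent : CountTerm := sub (const 1) (add (feat 0) (feat 1))

/-- A term that vanishes where `s` and `t` agree. -/
def dist (s t : CountTerm) : CountTerm := add (sub s t) (sub t s)

/-- For an indicator `k`, a term that vanishes where `k` is `0` or `t` vanishes. -/
def guard (k t : CountTerm) : CountTerm := sub k (sub (const 1) t)

/-- The number of vertices. -/
def order : CountTerm := read (const 1)

/-- A term that vanishes at all vertices if and only if the graph satisfies
`FeaturedGraph.IsGadget`. -/
def gadgetDefect : CountTerm :=
  add (sub (add (feat 0) (feat 1)) (const 1)) <|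
  add (guard isSource (add (agg isSource) (dist (agg isIdent) (const 1)))) <|
  add (guard isSink (add (agg isSink) (dist (agg isIdent) (const 1)))) <|
  guard isIdent (add (agg isIdent)
    (add (dist (agg isSource) (const 1)) (dist (agg isSink) (const 1))))

/-- In the gadgetisation of a digraph with `n` vertices, a term that vanishes at all vertices if and
only if every vertex of the digraph has total degree `n - 1`. The factor `3` accounts for the `3 n`
vertices of the gadgetisation. -/
def degreeDefect : CountTerm :=
  guard isIdent
    (dist (add (smul 3 (agg (add (agg isSource) (agg isSink)))) (const 3)) order)

/-- In the gadgetisation of a digraph with `n` vertices, the sum over all vertices of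
`agg (agg isSink)` is the sum of `d² + d + 2` over the out-degrees `d` of the digraph. If every
vertex has total degree `n - 1`, the term vanishes if and only if the sum of the squared out-degrees
is at least `0² + ⋯ + (n - 1)²`. -/
def squareDefect : CountTerm :=
  sub (add (read (read order)) (smul 45 order)) (smul 81 (read (agg (agg isSink))))

/-- A term that, on undirected graphs, vanishes exactly at the vertices of gadgetisations of strict
linear orders. -/
def orderDefect : CountTerm :=
  add (read (add gadgetDefect degreeDefect)) squareDefect

section Eval

variable {V : Type u} [Fintype V] (G : FeaturedGraph 2 V) (v : V)

open Classical in
theorem eval_isSource : isSource.eval V G v = if G.feat v = sourceFeat then 1 else 0 := by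
  simp only [isSource, eval, funext_iff, Fin.forall_fin_two, sourceFeat]
  cases G.feat v 0 <;> cases G.feat v 1 <;> simp

open Classical in
theorem eval_isSink : isSink.eval V G v = if G.feat v = sinkFeat then 1 else 0 := by
  simp only [isSink, eval, funext_iff, Fin.forall_fin_two, sinkFeat]
  cases G.feat v 0 <;> cases G.feat v 1 <;> simp

open Classical in
theorem eval_isIdent : isIdent.eval V G v = if G.feat v = identFeat then 1 else 0 := by
  simp only [isIdent, eval, funext_iff, Fin.forall_fin_two, identFeat]
  cases G.feat v 0 <;> cases G.feat v 1 <;> simp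

variable {G v}

theorem eval_dist_eq_zero_iff {s t : CountTerm} :
    (dist s t).eval V G v = 0 ↔ s.eval V G v = t.eval V G v := by
  simp only [dist, eval]; omega

theorem eval_guard_eq_zero_iff {k t : CountTerm} {P : Prop} [Decidable P]
    (hk : k.eval V G v = if P then 1 else 0) :
    (guard k t).eval V G v = 0 ↔ (P → t.eval V G v = 0) := by
  simp only [guard, eval, hk]
  split_ifs with h
  · simp only [h, true_imp_iff]; omega
  · simp [h]

theorem eval_agg_eq_zero_iff {k : CountTerm} {κ : Fin 2 → Bool} [DecidableEq (Fin 2 → Bool)]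
    (hk : ∀ w, k.eval V G w = if G.feat w = κ then 1 else 0) :
    (agg k).eval V G v = 0 ↔ ∀ w, G.Adj v w → G.feat w ≠ κ := by
  simp [eval, hk, FeaturedGraph.outNeighbors]

theorem eval_agg_eq_one_iff {k : CountTerm} {κ : Fin 2 → Bool} [DecidableEq (Fin 2 → Bool)]
    (hk : ∀ w, k.eval V G w = if G.feat w = κ then 1 else 0) :
    (agg k).eval V G v = 1 ↔ ∃! w, G.Adj v w ∧ G.feat w = κ := by
  simp only [eval, hk, FeaturedGraph.outNeighbors, ← Finset.card_filter]
  rw [Finset.card_eq_one, Finset.singleton_iff_unique_mem]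
  simp

theorem eval_gadgetDefect_eq_zero_iff :
    (∀ v, gadgetDefect.eval V G v = 0) ↔ G.IsGadget := by
  classical
  have hcases : ∀ v, (sub (add (feat 0) (feat 1)) (const 1)).eval V G v = 0 ↔
      (G.feat v = sourceFeat ∨ G.feat v = sinkFeat ∨ G.feat v = identFeat) := by
    intro v
    simp only [eval, funext_iff, Fin.forall_fin_two, sourceFeat, sinkFeat, identFeat]
    cases G.feat v 0 <;> cases G.feat v 1 <;> simp
  have hzero : ∀ s t : CountTerm, ∀ v, (add s t).eval V G v = 0 ↔
      s.eval V G v = 0 ∧ t.eval V G v = 0 := fun s t v => by simp [eval]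
  have hone : ∀ v, (const 1).eval V G v = 1 := fun v => rfl
  simp only [gadgetDefect, hzero, hcases, eval_guard_eq_zero_iff (eval_isSource G _),
    eval_guard_eq_zero_iff (eval_isSink G _), eval_guard_eq_zero_iff (eval_isIdent G _),
    eval_dist_eq_zero_iff, hone, eval_agg_eq_zero_iff (eval_isSource G),
    eval_agg_eq_zero_iff (eval_isSink G), eval_agg_eq_zero_iff (eval_isIdent G),
    eval_agg_eq_one_iff (eval_isSource G), eval_agg_eq_one_iff (eval_isSink G),
    eval_agg_eq_one_iff (eval_isIdent G)]
  constructor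
  · intro h
    refine ⟨fun v => (h v).1, fun v w hvw he => ?_, fun v hv => ((h v).2.1 hv).2,
      fun v hv => ((h v).2.2.1 hv).2, fun v hv => ((h v).2.2.2 hv).2.1,
      fun v hv => ((h v).2.2.2 hv).2.2⟩
    rcases (h v).1 with hv | hv | hv
    · exact ((h v).2.1 hv).1 w hvw (he ▸ hv)
    · exact ((h v).2.2.1 hv).1 w hvw (he ▸ hv)
    · exact ((h v).2.2.2 hv).1 w hvw (he ▸ hv)
  · intro h v
    have hne : ∀ κ, G.feat v = κ → ∀ w, G.Adj v w → G.feat w ≠ κ :=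
      fun κ hv w hvw hw => h.feat_ne v w hvw (hv.trans hw.symm)
    exact ⟨h.feat_cases v, fun hv => ⟨hne _ hv, h.source_ident v hv⟩,
      fun hv => ⟨hne _ hv, h.sink_ident v hv⟩,
      fun hv => ⟨hne _ hv, h.ident_source v hv, h.ident_sink v hv⟩⟩

end Eval

end CountTerm

section Gadgetisation

variable {W : Type u} [Fintype W] (D : Digraph W)

theorem GadgetVertex.sum_univ (f : GadgetVertex W → ℕ) :
    ∑ x, f x = ∑ w, f (.source w) + ∑ w, f (.sink w) + ∑ w, f (.ident w) := by
  rw [← (GadgetVertex.equivSum W).symm.sum_comp, Fintype.sum_sum_type, Fintype.sum_sum_type,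
    add_assoc]
  rfl

theorem GadgetVertex.card_eq : Fintype.card (GadgetVertex W) = 3 * Fintype.card W := by
  rw [Fintype.card_congr (GadgetVertex.equivSum W), Fintype.card_sum, Fintype.card_sum]
  omega

theorem Fintype.sum_ite_of_iff {p : W → Prop} [DecidablePred p] {i : W} (hp : ∀ w, p w ↔ w = i)
    (f : W → ℕ) : ∑ w, (if p w then f w else 0) = f i := by
  rw [Fintype.sum_eq_single i fun w hw => if_neg (mt (hp w).1 hw), if_pos ((hp i).2 rfl)]

open Classical in
theorem Digraph.sum_outNeighbors_source (f : GadgetVertex W → ℕ) (i : W) :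
    ∑ x ∈ D.gadgetisation.outNeighbors (.source i), f x =
      ∑ j, (if D.Adj i j then f (.sink j) else 0) + f (.ident i) := by
  have h1 : ∑ w, (if D.gadgetisation.Adj (.source i) (.source w) then f (.source w) else 0) = 0 :=
    Finset.sum_eq_zero fun w _ => if_neg id
  have h2 : ∑ w, (if D.gadgetisation.Adj (.source i) (.ident w) then f (.ident w) else 0) =
      f (.ident i) := Fintype.sum_ite_of_iff (fun w => eq_comm) fun w => f (.ident w)
  rw [FeaturedGraph.outNeighbors, Finset.sum_filter, GadgetVertex.sum_univ, h1, h2, zero_add]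
  rfl

open Classical in
theorem Digraph.sum_outNeighbors_sink (f : GadgetVertex W → ℕ) (j : W) :
    ∑ x ∈ D.gadgetisation.outNeighbors (.sink j), f x =
      ∑ i, (if D.Adj i j then f (.source i) else 0) + f (.ident j) := by
  have h1 : ∑ w, (if D.gadgetisation.Adj (.sink j) (.sink w) then f (.sink w) else 0) = 0 :=
    Finset.sum_eq_zero fun w _ => if_neg id
  have h2 : ∑ w, (if D.gadgetisation.Adj (.sink j) (.ident w) then f (.ident w) else 0) =
      f (.ident j) := Fintype.sum_ite_of_iff (fun w => Iff.rfl) fun w => f (.ident w)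
  rw [FeaturedGraph.outNeighbors, Finset.sum_filter, GadgetVertex.sum_univ, h1, h2, add_zero]
  rfl

theorem Digraph.sum_outNeighbors_ident (f : GadgetVertex W → ℕ) (i : W) :
    ∑ x ∈ D.gadgetisation.outNeighbors (.ident i), f x = f (.source i) + f (.sink i) := by
  classical
  have h1 : ∑ w, (if D.gadgetisation.Adj (.ident i) (.ident w) then f (.ident w) else 0) = 0 :=
    Finset.sum_eq_zero fun w _ => if_neg id
  have h2 : ∑ w, (if D.gadgetisation.Adj (.ident i) (.source w) then f (.source w) else 0) =
      f (.source i) := Fintype.sum_ite_of_iff (fun w => Iff.rfl) fun w => f (.source w)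
  have h3 : ∑ w, (if D.gadgetisation.Adj (.ident i) (.sink w) then f (.sink w) else 0) =
      f (.sink i) := Fintype.sum_ite_of_iff (fun w => eq_comm) fun w => f (.sink w)
  rw [FeaturedGraph.outNeighbors, Finset.sum_filter, GadgetVertex.sum_univ, h1, h2, h3,
    add_zero]

namespace CountTerm

theorem eval_agg_isSink_gadgetisation (x : GadgetVertex W) :
    (agg isSink).eval _ D.gadgetisation x =
      match x with
      | .source i => outDeg D.Adj i
      | .sink _ => 0
      | .ident _ => 1 := by
  classical
  rcases x with i | i | i <;>
    simp only [eval, eval_isSink, Digraph.sum_outNeighbors_source, Digraph.sum_outNeighbors_sink,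
      Digraph.sum_outNeighbors_ident] <;>
    simp [Digraph.gadgetisation, sinkFeat, outDeg]

theorem eval_agg_isSource_gadgetisation (x : GadgetVertex W) :
    (agg isSource).eval _ D.gadgetisation x =
      match x with
      | .source _ => 0
      | .sink j => inDeg D.Adj j
      | .ident _ => 1 := by
  classical
  rcases x with i | i | i <;>
    simp only [eval, eval_isSource, Digraph.sum_outNeighbors_source, Digraph.sum_outNeighbors_sink,
      Digraph.sum_outNeighbors_ident] <;>
    simp [Digraph.gadgetisation, sourceFeat, inDeg, outDeg]

theorem eval_order_gadgetisation (x : GadgetVertex W) :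
    order.eval _ D.gadgetisation x = 3 * Fintype.card W := by
  simp [order, eval, GadgetVertex.card_eq]

theorem eval_degreeDefect_eq_zero_iff :
    (∀ x, degreeDefect.eval _ D.gadgetisation x = 0) ↔
      ∀ i, outDeg D.Adj i + inDeg D.Adj i + 1 = Fintype.card W := by
  classical
  have hval : ∀ i, (agg (add (agg isSource) (agg isSink))).eval _ D.gadgetisation (.ident i) =
      outDeg D.Adj i + inDeg D.Adj i := by
    intro i
    have h : (agg (add (agg isSource) (agg isSink))).eval _ D.gadgetisation (.ident i) =
        ∑ x ∈ D.gadgetisation.outNeighbors (.ident i),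
          ((agg isSource).eval _ D.gadgetisation x + (agg isSink).eval _ D.gadgetisation x) := rfl
    rw [h, Digraph.sum_outNeighbors_ident]
    simp only [eval_agg_isSource_gadgetisation, eval_agg_isSink_gadgetisation]
    omega
  have hval' : ∀ i, (add (smul 3 (agg (add (agg isSource) (agg isSink)))) (const 3)).eval _
      D.gadgetisation (.ident i) = 3 * (outDeg D.Adj i + inDeg D.Adj i) + 3 := fun i => by
    rw [← hval]; rfl
  simp only [degreeDefect, eval_guard_eq_zero_iff (eval_isIdent D.gadgetisation _),
    eval_dist_eq_zero_iff, eval_order_gadgetisation]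
  constructor
  · intro h i
    have := h (.ident i) rfl
    rw [hval'] at this
    omega
  · rintro h (i | i | i) hx
    · exact absurd hx (by simp [Digraph.gadgetisation, identFeat])
    · exact absurd hx (by simp [Digraph.gadgetisation, identFeat])
    · rw [hval', ← h i]
      omega

theorem eval_read_agg_agg_isSink (x : GadgetVertex W) :
    (read (agg (agg isSink))).eval _ D.gadgetisation x =
      ∑ i, outDeg D.Adj i ^ 2 + ∑ i, outDeg D.Adj i + 2 * Fintype.card W := by
  classical
  have h : (read (agg (agg isSink))).eval _ D.gadgetisation x =
      ∑ y, ∑ z ∈ D.gadgetisation.outNeighbors y, (agg isSink).eval _ D.gadgetisation z := rfl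
  rw [h, GadgetVertex.sum_univ]
  simp only [Digraph.sum_outNeighbors_source, Digraph.sum_outNeighbors_sink,
    Digraph.sum_outNeighbors_ident, eval_agg_isSink_gadgetisation]
  have hsq : ∑ j, ∑ i, (if D.Adj i j then outDeg D.Adj i else 0) = ∑ i, outDeg D.Adj i ^ 2 := by
    rw [Finset.sum_comm]
    refine Finset.sum_congr rfl fun i _ => ?_
    rw [← Finset.sum_filter, Finset.sum_const, smul_eq_mul, sq]
    rfl
  simp only [Finset.sum_add_distrib, hsq]
  simp
  ring

theorem eval_squareDefect_eq_zero_iff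
    (hdeg : ∀ i, outDeg D.Adj i + inDeg D.Adj i + 1 = Fintype.card W) (x : GadgetVertex W) :
    squareDefect.eval _ D.gadgetisation x = 0 ↔
      ∑ i ∈ Finset.range (Fintype.card W), i ^ 2 ≤ ∑ i, outDeg D.Adj i ^ 2 := by
  have h1 : 2 * ∑ i, outDeg D.Adj i + Fintype.card W = Fintype.card W ^ 2 := by
    have h := Finset.sum_congr rfl fun i (_ : i ∈ Finset.univ) => hdeg i
    simp only [Finset.sum_add_distrib, ← sum_outDeg_eq_sum_inDeg, Finset.sum_const,
      Finset.card_univ, smul_eq_mul] at h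
    rw [sq, ← h]; ring
  have h2 := six_mul_sum_sq (Fintype.card W)
  have h3 : (read (read order)).eval _ D.gadgetisation x = 27 * Fintype.card W ^ 3 := by
    have h : (read (read order)).eval _ D.gadgetisation x =
      ∑ _y : GadgetVertex W, ∑ z : GadgetVertex W, order.eval _ D.gadgetisation z := rfl
    rw [h]
    simp only [eval_order_gadgetisation, GadgetVertex.card_eq, Finset.sum_const, Finset.card_univ,
      smul_eq_mul]
    ring
  change (read (read order)).eval _ D.gadgetisation x + 45 * order.eval _ D.gadgetisation x -
    81 * (read (agg (agg isSink))).eval _ D.gadgetisation x = 0 ↔ _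
  rw [h3, eval_order_gadgetisation, eval_read_agg_agg_isSink, Nat.sub_eq_zero_iff_le]
  omega

theorem eval_orderDefect_eq_zero_iff {V : Type u} [Fintype V] {G : FeaturedGraph 2 V}
    (hG : G.IsUndirected) (v : V) :
    orderDefect.eval V G v = 0 ↔ gadgetisedStrictLinearOrder V G v := by
  have hsum : orderDefect.eval V G v = 0 ↔
      ((∀ w, gadgetDefect.eval V G w = 0) ∧ ∀ w, degreeDefect.eval V G w = 0) ∧
        squareDefect.eval V G v = 0 := by
    simp [orderDefect, eval, forall_and]
  rw [hsum, eval_gadgetDefect_eq_zero_iff]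
  have hiso : ∀ {W : Type u} [Fintype W] {D : Digraph W}, G.Isomorphic D.gadgetisation →
      ((∀ w, degreeDefect.eval V G w = 0) ∧ squareDefect.eval V G v = 0 ↔
        (∀ i, outDeg D.Adj i + inDeg D.Adj i + 1 = Fintype.card W) ∧
        ∑ i ∈ Finset.range (Fintype.card W), i ^ 2 ≤ ∑ i, outDeg D.Adj i ^ 2) := by
    rintro W _ D ⟨e, hadj, hfeat⟩
    have hdeg : (∀ w, degreeDefect.eval V G w = 0) ↔
        ∀ i, outDeg D.Adj i + inDeg D.Adj i + 1 = Fintype.card W := by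
      rw [← eval_degreeDefect_eq_zero_iff, ← e.forall_congr_right]
      simp only [eval_equiv _ e hadj hfeat]
    rw [hdeg, eval_equiv squareDefect e hadj hfeat]
    exact and_congr_right fun h => eval_squareDefect_eq_zero_iff D h _
  constructor
  · rintro ⟨⟨h1, h2⟩, h3⟩
    classical
    have hi := h1.isomorphic hG
    obtain ⟨h4, h5⟩ := (hiso hi).1 ⟨h2, h3⟩
    exact ⟨_, _, isStrictTotalOrder_of_sum_sq_outDeg _ h4 h5, hi⟩
  · rintro ⟨W, D, hD, hi⟩
    obtain ⟨e, hadj, hfeat⟩ := id hi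
    have : Fintype W := Fintype.ofInjective (fun w => e.symm (.ident w)) fun a b hab => by
      simpa using hab
    obtain ⟨h2, h3⟩ := (hiso hi).2
      ⟨IsStrictTotalOrder.outDeg_add_inDeg D.Adj, (IsStrictTotalOrder.sum_sq_outDeg D.Adj).ge⟩
    exact ⟨⟨(FeaturedGraph.isGadget_gadgetisation D).of_equiv e hadj hfeat, h2⟩, h3⟩

end CountTerm
end Gadgetisation

end

/-! ### The separation -/

theorem mainTheorem2 :
    ∃ φ : FOClassifier 2,
      EquivOverUndirected φ.property gadgetisedStrictLinearOrder.{u} ∧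
      (∀ ψ : C2Classifier 2, ¬ EquivOverUndirected.{u} φ.property ψ.property) ∧
      ∃ N : ACRGNN 2, N.IsSimple ∧ EquivOverUndirected.{u} N.property φ.property := by
  have hφ : EquivOverUndirected (FOClassifier.property FeaturedGraph.gadgetOrderFormula)
      gadgetisedStrictLinearOrder.{u} := fun V _ G v hG => by
    rw [property_gadgetOrderFormula, FeaturedGraph.gadgetisedStrictLinearOrder_iff hG]
  obtain ⟨N, hN, hprop⟩ := CountTerm.orderDefect.exists_isSimple
  refine ⟨FeaturedGraph.gadgetOrderFormula, hφ, fun ψ hψ => ?_, N, hN, fun V _ G v hG => ?_⟩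
  · exact not_equivOverUndirected_c2Classifier ψ fun V _ G v hG =>
      (hφ V G v hG).symm.trans (hψ V G v hG)
  · rw [hprop, CountTerm.eval_orderDefect_eq_zero_iff hG, hφ V G v hG]
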